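/- Let $\mathcal U$ be a finite set of controls and $\nu$ a measure on $\mathbb R$. For each $u\in\mathcal U$ let $p_u(y;t)=h_u(y)\exp(tT_u(y)-A_u(t))$, $t\in\Psi_u$, be a single-parameter exponential family of densities with respect to $\nu$, where $h_u\ge 0$ (not $\nu$-a.e. zero) and $T_u$ are measurable, $A_u(t)=\log\int h_u e^{tT_u}\,d\nu$, and $\Psi_u\subset\mathbb R$ is an interval contained in the interior of $\{t:\int h_u e^{tT_u}\,d\nu<\infty\}$. Let $\bm\theta\in\Omega:=\prod_u\Psi_u$. Let $(U_k,Y_k)_{k\ge1}$ be random controls and real observations on a probability space such that, with $\mathcal F_k=\sigma(U_1,Y_1,\dots,U_k,Y_k)$, for every $k\ge1$ the control $U_k$ is $\mathcal F_{k-1}$-measurable and, given $\mathcal F_{k-1}$, the observation $Y_k$ has density $p_{U_k}(\cdot\,;\theta_{U_k})$ with respect to $\nu$. Write $\mathbb P_{\bm\theta}$ for the probability, $N_u(n)=\#\{1\le k\le n:U_k=u\}$, and $$D_u(\bm\vartheta\|\bm\theta)=\int p_u(y;\vartheta_u)\log\frac{p_u(y;\vartheta_u)}{p_u(y;\theta_u)}\,d\nu(y).$$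 Let $\bm\theta^*(n)\in\arg\max_{\bm\theta'\in\Omega}\prod_{u}\prod_{k\le n,\,U_k=u}p_u(Y_k;\theta'_u)$ be a maximum likelihood estimate. Theorem. For every integer $n\ge2$ and every real $\beta\ge|\mathcal U|+1+\log 2$, $$\mathbb P_{\bm\theta}\Big[\sum_{u\in\mathcal U}N_u(n)\,D_u(\bm\theta^*(n)\|\bm\theta)\ge\beta\Big]\le 2e^{-\beta}\Big(\frac{\beta\lceil\beta\log n\rceil}{|\mathcal U|}\Big)^{|\mathcal U|}e^{|\mathcal U|+1},$$ where the event is restricted to the outcomes on which $\bm\theta^*(n)$ exists. The same bound holds, with no such restriction, for the (outer) probability that there is a sequence $\bm\vartheta^{(j)}\in\Omega$ along which the likelihood tends to its supremum over $\Omega$ and $\liminf_{j\to\infty}\sum_{u}N_u(n)D_u(\bm\vartheta^{(j)}\|\bm\theta)\ge\beta$. -/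

import Mathlib

open MeasureTheory ProbabilityTheory Filter Topology Set

noncomputable section

namespace ControlledSensing

/-- The set of real `t` at which the partition function `∫ h(y) exp(t T(y)) dν(y)` is finite. -/
def naturalParameters (ν : Measure ℝ) (h T : ℝ → ℝ) : Set ℝ :=
  {t | Integrable (fun y => h y * Real.exp (t * T y)) ν}

/-- A single-parameter exponential family, in natural parametrization, of densities
`p(y; t) = h(y) exp(t T(y) - A(t))` with respect to `ν`, with an interval `Ψ` of parameters on which
the log-partition function is smooth. -/
structure ExpFamily (ν : Measure ℝ) where
  /-- the carrier function -/
  h : ℝ → ℝ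
  /-- the statistic -/
  T : ℝ → ℝ
  /-- the parameter set -/
  Ψ : Set ℝ
  measurable_h : Measurable h
  measurable_T : Measurable T
  h_nonneg : ∀ y, 0 ≤ h y
  h_nontrivial : ¬ h =ᵐ[ν] 0
  convex_Ψ : Convex ℝ Ψ
  Ψ_subset : Ψ ⊆ interior (naturalParameters ν h T)

namespace ExpFamily

variable {ν : Measure ℝ}

/-- The log-partition function `A`. -/
def logPartition (F : ExpFamily ν) (t : ℝ) : ℝ :=
  Real.log (∫ y, F.h y * Real.exp (t * F.T y) ∂ν)

/-- The density `p(y; t)` with respect to `ν`. -/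
def density (F : ExpFamily ν) (t y : ℝ) : ℝ :=
  F.h y * Real.exp (t * F.T y - F.logPartition t)

/-- The distribution with natural parameter `t`. -/
def law (F : ExpFamily ν) (t : ℝ) : Measure ℝ :=
  ν.withDensity fun y => ENNReal.ofReal (F.density t y)

/-- The Kullback-Leibler divergence `D(s ‖ t)` between the members with parameters `s` and `t`. -/
def kl (F : ExpFamily ν) (s t : ℝ) : ℝ :=
  ∫ y, F.density s y * Real.log (F.density s y / F.density t y) ∂ν

end ExpFamily

variable {Ω 𝒰 : Type*} {ν : Measure ℝ}

/-- The σ-algebra generated by `U₁, Y₁, …, Uₙ, Yₙ` (trivial for `n = 0`). -/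
@[reducible] def history [MeasurableSpace 𝒰] (U : ℕ → Ω → 𝒰) (Y : ℕ → Ω → ℝ) (n : ℕ) : MeasurableSpace Ω :=
  ⨆ k ∈ Finset.Icc 1 n,
    (MeasurableSpace.comap (U k) inferInstance ⊔ MeasurableSpace.comap (Y k) inferInstance)

/-- Under `P`, the vector of parameters is `θ`: at each time `k ≥ 1` the control `U k` is a function
of the past controls and observations, and given the past the observation `Y k` has the law of the
exponential family of the control `U k`, with parameter the coordinate of `θ` at `U k`. -/
structure IsControlledProcess [MeasurableSpace Ω] [MeasurableSpace 𝒰] (F : 𝒰 → ExpFamily ν)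
    (θ : 𝒰 → ℝ) (U : ℕ → Ω → 𝒰) (Y : ℕ → Ω → ℝ) (P : Measure Ω) : Prop where
  measurable_U : ∀ k, 1 ≤ k → Measurable (U k)
  measurable_Y : ∀ k, 1 ≤ k → Measurable (Y k)
  predictable_U : ∀ k, 1 ≤ k → Measurable[history U Y (k - 1)] (U k)
  condLaw_Y : ∀ k, 1 ≤ k → ∀ B : Set ℝ, MeasurableSet B →
    P⟦Y k ⁻¹' B | history U Y (k - 1)⟧ =ᵐ[P] fun ω => ((F (U k ω)).law (θ (U k ω))).real B

/-- The domain `∏ᵤ Ψᵤ` of the vector of parameters. -/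
def paramDomain (F : 𝒰 → ExpFamily ν) : Set (𝒰 → ℝ) := {θ | ∀ u, θ u ∈ (F u).Ψ}

/-- The number `N_u(n)` of times that control `u` is chosen up to time `n`. -/
def count [DecidableEq 𝒰] (U : ℕ → Ω → 𝒰) (u : 𝒰) (n : ℕ) (ω : Ω) : ℕ :=
  ((Finset.Icc 1 n).filter fun k => U k ω = u).card

/-- The likelihood at `θ` of the observations collected up to time `n`. -/
def likelihood [Fintype 𝒰] [DecidableEq 𝒰] (F : 𝒰 → ExpFamily ν) (U : ℕ → Ω → 𝒰) (Y : ℕ → Ω → ℝ)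
    (n : ℕ) (ω : Ω) (θ : 𝒰 → ℝ) : ℝ :=
  ∏ u, ∏ k ∈ (Finset.Icc 1 n).filter (fun k => U k ω = u), (F u).density (θ u) (Y k ω)

/-- `ϑ` is a global maximum likelihood estimate at time `n` on the outcome `ω`. -/
def IsMLE [Fintype 𝒰] [DecidableEq 𝒰] (F : 𝒰 → ExpFamily ν) (U : ℕ → Ω → 𝒰) (Y : ℕ → Ω → ℝ)
    (n : ℕ) (ω : Ω) (ϑ : 𝒰 → ℝ) : Prop :=
  ϑ ∈ paramDomain F ∧ IsMaxOn (likelihood F U Y n ω) (paramDomain F) ϑ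

/-- `ϑ 0, ϑ 1, …` is a sequence in the parameter domain along which the likelihood tends to its
supremum. -/
def IsMLESeq [Fintype 𝒰] [DecidableEq 𝒰] (F : 𝒰 → ExpFamily ν) (U : ℕ → Ω → 𝒰) (Y : ℕ → Ω → ℝ)
    (n : ℕ) (ω : Ω) (ϑ : ℕ → 𝒰 → ℝ) : Prop :=
  (∀ j, ϑ j ∈ paramDomain F) ∧
    ∀ θ' ∈ paramDomain F, ∀ ℓ < likelihood F U Y n ω θ',
      ∀ᶠ j in atTop, ℓ < likelihood F U Y n ω (ϑ j)

/-- The statistic `∑ᵤ N_u(n) D_u(ϑ ‖ θ)`; controls not chosen up to time `n` contribute `0`. -/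
def weightedKL [Fintype 𝒰] [DecidableEq 𝒰] (F : 𝒰 → ExpFamily ν) (U : ℕ → Ω → 𝒰)
    (n : ℕ) (ω : Ω) (ϑ θ : 𝒰 → ℝ) : ℝ :=
  ∑ u, (count U u n ω : ℝ) * (F u).kl (ϑ u) (θ u)

end ControlledSensing

end

/-! Split the log-likelihood ratio against `θ` by control. In coordinate `u` it is `gain`, a concave
function of the parameter with slope `S - N * m`. If a maximizer lies beyond the point `r` at
divergence `d` from `θ u`, the slope at `r` points towards it, and this alone makes the gain at `r`
at least `N * d` (`eventually_mul_le_gain`). So the random maximizer can be replaced by fixed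
points: those on both sides of `θ u` with divergences β, βa, …, βa^m. Rounding down to a level costs
a factor `a`, divergences above β are capped, and `θ u` itself serves when `N * d ≤ ε`
(`eventually_exists_grid`).

Each parameter vector in the domain has a likelihood ratio of expectation one, even with adaptive
controls (`lintegral_prod_ratio`). With K controls, the product over controls of the sums over the
2m+3 grid points therefore has expectation (2m+3)^K. On the event it is at least exp(a(β - Kε))
(`exp_le_prod_sum_grid`), so Markov's inequality yields `measureReal_le`. Passing to single
coordinates requires each log-ratio to be bounded above; by Fatou this holds almost surely
(`ae_bddAbove_logRatio`).

Taking a = 1 - K/β loses only e^K from the exponent β, and ε = 1/4 asks for about (β/K) log(4βn)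
levels. `bound_trivial_or_exists` checks that the stated bound absorbs this when β ≥ 4K and is
trivial when β ≤ 4K. -/

noncomputable section

namespace ControlledSensing

/-! ### Exponential families: mean, tangents, divergence, likelihood ratios -/

namespace ExpFamily

variable {ν : Measure ℝ} (F : ExpFamily ν)

/-- The carrier measure `h dν`. -/
def carrier : Measure ℝ := ν.withDensity fun y => ENNReal.ofReal (F.h y)

/-- The expectation of the statistic under the member with parameter `t`. -/
def mean (t : ℝ) : ℝ := ∫ y, F.density t y * F.T y ∂ν

lemma measurable_density (t : ℝ) : Measurable (F.density t) := by
  unfold density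
  have := F.measurable_h
  have := F.measurable_T
  fun_prop

lemma density_nonneg (t y : ℝ) : 0 ≤ F.density t y :=
  mul_nonneg (F.h_nonneg y) (Real.exp_pos _).le

lemma integrable_carrier_iff {g : ℝ → ℝ} :
    Integrable g F.carrier ↔ Integrable (fun y => F.h y * g y) ν := by
  unfold carrier
  rw [integrable_withDensity_iff_integrable_smul' F.measurable_h.ennreal_ofReal (by simp)]
  simp [ENNReal.toReal_ofReal, F.h_nonneg]

lemma integral_carrier (g : ℝ → ℝ) : ∫ y, g y ∂F.carrier = ∫ y, F.h y * g y ∂ν := by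
  unfold carrier
  rw [integral_withDensity_eq_integral_toReal_smul F.measurable_h.ennreal_ofReal (by simp)]
  simp [ENNReal.toReal_ofReal, F.h_nonneg]

/-- With the carrier as base measure, the family falls under the theory of `cgf`, which supplies
analyticity in the interior. -/
lemma naturalParameters_eq :
    naturalParameters ν F.h F.T = integrableExpSet F.T F.carrier := by
  ext t
  exact F.integrable_carrier_iff.symm

lemma logPartition_eq : F.logPartition = cgf F.T F.carrier := by
  ext t
  simp only [logPartition, cgf, mgf, integral_carrier]

variable {F} {s t : ℝ}

lemma mem_interior (ht : t ∈ F.Ψ) : t ∈ interior (integrableExpSet F.T F.carrier) := by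
  rw [← naturalParameters_eq]
  exact F.Ψ_subset ht

lemma mem_integrableExpSet (ht : t ∈ F.Ψ) : t ∈ integrableExpSet F.T F.carrier :=
  interior_subset (mem_interior ht)

variable (F) in
lemma carrier_ne_zero : F.carrier ≠ 0 := by
  unfold carrier
  rw [Ne, withDensity_eq_zero_iff F.measurable_h.ennreal_ofReal.aemeasurable]
  intro h
  apply F.h_nontrivial
  filter_upwards [h] with y hy
  simpa using le_antisymm (by simpa using hy) (F.h_nonneg y)

lemma exp_logPartition (ht : t ∈ F.Ψ) : Real.exp (F.logPartition t) = mgf F.T F.carrier t := by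
  have : NeZero F.carrier := ⟨F.carrier_ne_zero⟩
  rw [logPartition_eq, exp_cgf (mem_integrableExpSet ht)]

variable (F) in
lemma density_eq (t y : ℝ) :
    F.density t y = Real.exp (-F.logPartition t) * (F.h y * Real.exp (t * F.T y)) := by
  rw [density, sub_eq_add_neg, Real.exp_add]
  ring

lemma integrable_density (ht : t ∈ F.Ψ) : Integrable (F.density t) ν := by
  have h : Integrable (fun y => F.h y * Real.exp (t * F.T y)) ν :=
    interior_subset (s := naturalParameters ν F.h F.T) (F.Ψ_subset ht)
  exact (h.const_mul (Real.exp (-F.logPartition t))).congr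
    (Eventually.of_forall fun y => (F.density_eq t y).symm)

lemma integral_density (ht : t ∈ F.Ψ) : ∫ y, F.density t y ∂ν = 1 := by
  simp_rw [density_eq, integral_const_mul]
  rw [← F.integral_carrier fun y => Real.exp (t * F.T y)]
  change _ * mgf F.T F.carrier t = 1
  rw [← exp_logPartition ht, ← Real.exp_add, neg_add_cancel, Real.exp_zero]

lemma integrable_density_mul_statistic (ht : t ∈ F.Ψ) :
    Integrable (fun y => F.density t y * F.T y) ν := by
  have h := integrable_pow_mul_exp_of_mem_interior_integrableExpSet (mem_interior ht) 1
  rw [integrable_carrier_iff] at h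
  refine (h.const_mul (Real.exp (-F.logPartition t))).congr (Eventually.of_forall fun y => ?_)
  simp only [density_eq, pow_one]
  ring

/-- Serves only the continuity of the mean; the tangent inequality is proved without
differentiation. -/
lemma mean_eq_deriv (ht : t ∈ F.Ψ) : F.mean t = deriv (cgf F.T F.carrier) t := by
  rw [deriv_cgf (mem_interior ht), ← exp_logPartition ht, mean, integral_carrier, div_eq_inv_mul,
    ← Real.exp_neg, ← integral_const_mul]
  congr 1
  ext y
  rw [density_eq]
  ring

variable (F) in
lemma continuousOn_logPartition : ContinuousOn F.logPartition F.Ψ := fun t ht => by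
  rw [logPartition_eq]
  exact (analyticAt_cgf (mem_interior ht)).continuousAt.continuousWithinAt

variable (F) in
lemma continuousOn_mean : ContinuousOn F.mean F.Ψ := by
  refine ContinuousOn.congr (f := deriv (cgf F.T F.carrier)) (fun t ht => ?_)
    fun t ht => mean_eq_deriv ht
  exact (analyticAt_cgf (mem_interior ht)).deriv.continuousAt.continuousWithinAt

variable (F) in
lemma density_mul_exp (s t y : ℝ) :
    F.density s y * Real.exp ((t - s) * F.T y - (F.logPartition t - F.logPartition s)) =
      F.density t y := by
  rw [density, density, mul_assoc, ← Real.exp_add]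
  ring_nf

/-- The log-partition function lies above its tangents. -/
lemma tangent_le (hs : s ∈ F.Ψ) (ht : t ∈ F.Ψ) :
    F.logPartition s + (t - s) * F.mean s ≤ F.logPartition t := by
  have h1 : ∫ y, (F.density s y * (1 - (F.logPartition t - F.logPartition s)) +
      (t - s) * (F.density s y * F.T y)) ∂ν ≤ ∫ y, F.density t y ∂ν := by
    refine integral_mono (((integrable_density hs).mul_const _).add
      ((integrable_density_mul_statistic hs).const_mul _)) (integrable_density ht) fun y => ?_
    -- `1 + x ≤ exp x` at the log-likelihood ratio `x`, weighted by the density at `s`.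
    have := mul_le_mul_of_nonneg_left
      (Real.add_one_le_exp ((t - s) * F.T y - (F.logPartition t - F.logPartition s)))
      (F.density_nonneg s y)
    rw [density_mul_exp] at this
    linarith
  rw [integral_add ((integrable_density hs).mul_const _)
    ((integrable_density_mul_statistic hs).const_mul _), integral_mul_const, integral_const_mul,
    integral_density hs, integral_density ht, ← mean] at h1
  linarith

/-- The log-ratio is affine in `T` where `h` is positive, and the integrand vanishes elsewhere. All
integrals are under `s`, so `t` can be arbitrary. -/
lemma kl_eq (hs : s ∈ F.Ψ) (t : ℝ) :
    F.kl s t = (s - t) * F.mean s - F.logPartition s + F.logPartition t := by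
  have h : ∀ y, F.density s y * Real.log (F.density s y / F.density t y) =
      (s - t) * (F.density s y * F.T y) +
        F.density s y * (F.logPartition t - F.logPartition s) := by
    intro y
    rcases (F.h_nonneg y).eq_or_lt' with h0 | h0
    · simp [density, h0]
    · have : F.density s y / F.density t y =
          Real.exp ((s - t) * F.T y - (F.logPartition s - F.logPartition t)) := by
        rw [div_eq_iff (show F.density t y ≠ 0 from (mul_pos h0 (Real.exp_pos _)).ne'), mul_comm, density_mul_exp]
      rw [this, Real.log_exp]
      ring
  simp_rw [kl, h]
  rw [integral_add ((integrable_density_mul_statistic hs).const_mul _)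
    ((integrable_density hs).mul_const _), integral_mul_const, integral_const_mul,
    integral_density hs, ← mean]
  ring

/-- The likelihood ratio of the members with parameters `s` and `t` at `y`. -/
def ratio (F : ExpFamily ν) (s t y : ℝ) : ℝ :=
  Real.exp ((s - t) * F.T y - (F.logPartition s - F.logPartition t))

variable (F) in
lemma measurable_ratio (s t : ℝ) : Measurable (F.ratio s t) := by
  unfold ratio
  have := F.measurable_T
  fun_prop

lemma lintegral_density (ht : t ∈ F.Ψ) : ∫⁻ y, ENNReal.ofReal (F.density t y) ∂ν = 1 := by
  rw [← ofReal_integral_eq_lintegral_ofReal (integrable_density ht)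
    (Eventually.of_forall (F.density_nonneg t)), integral_density ht, ENNReal.ofReal_one]

lemma isProbabilityMeasure_law (ht : t ∈ F.Ψ) : IsProbabilityMeasure (F.law t) :=
  ⟨by rw [law, withDensity_apply _ MeasurableSet.univ, setLIntegral_univ, lintegral_density ht]⟩

lemma lintegral_ratio (hs : s ∈ F.Ψ) (t : ℝ) :
    ∫⁻ y, ENNReal.ofReal (F.ratio s t y) ∂F.law t = 1 := by
  rw [law, lintegral_withDensity_eq_lintegral_mul _ (F.measurable_density t).ennreal_ofReal
    (F.measurable_ratio s t).ennreal_ofReal, ← lintegral_density hs]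
  refine lintegral_congr fun y => ?_
  rw [Pi.mul_apply, ← ENNReal.ofReal_mul (F.density_nonneg t y), ratio, density_mul_exp]

variable (F) in
lemma law_carrier_zero (t : ℝ) : F.law t {y | F.h y = 0} = 0 := by
  have hm : MeasurableSet {y | F.h y = 0} := F.measurable_h (measurableSet_singleton 0)
  rw [law, withDensity_apply _ hm]
  refine (setLIntegral_congr_fun (g := fun _ => 0) hm fun y hy => ?_).trans (by simp)
  simp [density, show F.h y = 0 from hy]

end ExpFamily

/-! ### Convex potentials on the line: from maximizers to fixed points -/

/-- A continuous function `φ` on a convex set `J` of reals, lying above its tangents, with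
continuous slopes `m`. -/
structure ConvexPotential where
  /-- the domain -/
  J : Set ℝ
  /-- the function -/
  φ : ℝ → ℝ
  /-- the slope -/
  m : ℝ → ℝ
  convex_J : Convex ℝ J
  continuousOn_φ : ContinuousOn φ J
  continuousOn_m : ContinuousOn m J
  tangent_le : ∀ r ∈ J, ∀ s ∈ J, φ r + (s - r) * m r ≤ φ s

namespace ConvexPotential

/-- The reflection of a potential at the origin. -/
def reflect (C : ConvexPotential) : ConvexPotential where
  J := {r | -r ∈ C.J}
  φ r := C.φ (-r)
  m r := -C.m (-r)
  convex_J := C.convex_J.linear_preimage (-LinearMap.id : ℝ →ₗ[ℝ] ℝ)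
  continuousOn_φ := C.continuousOn_φ.comp continuous_neg.continuousOn fun _ h => h
  continuousOn_m := (C.continuousOn_m.comp continuous_neg.continuousOn fun _ h => h).neg
  tangent_le r hr s hs := by
    have := C.tangent_le (-r) hr (-s) hs
    linarith

/-- The Bregman divergence of the potential. -/
def div (C : ConvexPotential) (s t : ℝ) : ℝ := (s - t) * C.m s - C.φ s + C.φ t

/-- The log-likelihood ratio of `s` to `t` for `N` observations with total statistic `S`. -/
def gain (C : ConvexPotential) (N S s t : ℝ) : ℝ := (s - t) * S - N * (C.φ s - C.φ t)

lemma div_reflect (C : ConvexPotential) (s t : ℝ) : C.reflect.div (-s) (-t) = C.div s t := by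
  simp only [div, reflect, neg_neg]
  ring

lemma gain_reflect (C : ConvexPotential) (N S s t : ℝ) :
    C.reflect.gain N (-S) (-s) (-t) = C.gain N S s t := by
  simp only [gain, reflect, neg_neg]
  ring

lemma gain_self (C : ConvexPotential) (N S t : ℝ) : C.gain N S t t = 0 := by
  simp [gain]

variable {C : ConvexPotential} {r s t N S : ℝ}

/-- Concavity of the gain: its tangent at `r` has slope `S - N * C.m r`. -/
lemma gain_le (hr : r ∈ C.J) (hs : s ∈ C.J) (hN : 0 ≤ N) :
    C.gain N S s t ≤ C.gain N S r t + (s - r) * (S - N * C.m r) := by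
  have := mul_le_mul_of_nonneg_left (C.tangent_le r hr s hs) hN
  simp only [gain]
  linarith

lemma slope_mono (hr : r ∈ C.J) (hs : s ∈ C.J) (hrs : r ≤ s) : C.m r ≤ C.m s := by
  rcases hrs.eq_or_lt with rfl | h
  · rfl
  have h1 := C.tangent_le r hr s hs
  have h2 := C.tangent_le s hs r hr
  have : 0 ≤ (s - r) * (C.m s - C.m r) := by linarith
  have := nonneg_of_mul_nonneg_right this (sub_pos.2 h)
  linarith

/-- The difference is the tangent gap at `r` of the tangent at `s`, plus `(r - t) * (m s - m r)`. -/
lemma div_mono (hr : r ∈ C.J) (hs : s ∈ C.J) (htr : t ≤ r) (hrs : r ≤ s) :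
    C.div r t ≤ C.div s t := by
  have h1 := C.tangent_le s hs r hr
  have h2 := mul_nonneg (sub_nonneg.2 htr) (sub_nonneg.2 (slope_mono hr hs hrs))
  simp only [div]
  linarith

lemma exists_div_eq {d : ℝ} (ht : t ∈ C.J) (hs : s ∈ C.J) (hts : t ≤ s) (hd : 0 ≤ d)
    (hds : d ≤ C.div s t) : ∃ r ∈ C.J, t ≤ r ∧ C.div r t = d := by
  have hsub : Icc t s ⊆ C.J := by
    rw [← segment_eq_Icc hts]
    exact C.convex_J.segment_subset ht hs
  have hc : ContinuousOn (fun r => C.div r t) (Icc t s) := by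
    have h1 := C.continuousOn_φ.mono hsub
    have h2 := C.continuousOn_m.mono hsub
    unfold div
    fun_prop
  obtain ⟨r, hr, hrd⟩ := intermediate_value_Icc hts hc
    (show d ∈ Icc (C.div t t) (C.div s t) from ⟨by simpa [div] using hd, hds⟩)
  exact ⟨r, hsub hr, hr.1, hrd⟩

/-- Equality holds at `S = N * C.m s`, and for `t ≤ s` the gain is nondecreasing in `S`. -/
lemma mul_div_le_gain (hts : t ≤ s) (hS : N * C.m s ≤ S) :
    N * C.div s t ≤ C.gain N S s t := by
  have := mul_le_mul_of_nonneg_left hS (sub_nonneg.2 hts)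
  simp only [gain, div]
  linarith

/-- A sequence that maximizes the gain is eventually to the left of each point at which the gain
has negative slope. -/
lemma eventually_lt_of_slope {x : ℕ → ℝ} (ht : t ∈ C.J) (hr : r ∈ C.J) (htr : t < r) (hN : 0 ≤ N)
    (hS : S < N * C.m r) (hx : ∀ j, x j ∈ C.J)
    (hmax : ∀ y ∈ C.J, ∀ ε > 0, ∀ᶠ j in atTop, C.gain N S y t - ε < C.gain N S (x j) t) :
    ∀ᶠ j in atTop, x j < r := by
  have hsub : Icc t r ⊆ C.J := by
    rw [← segment_eq_Icc htr.le]
    exact C.convex_J.segment_subset ht hr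
  -- By continuity the slope is already negative slightly left of `r`; the gain at `y` then beats
  -- every gain from `r` onwards by a fixed margin.
  obtain ⟨y, hy, hyr, hSy⟩ : ∃ y ∈ C.J, y < r ∧ S < N * C.m y := by
    have hc : ContinuousWithinAt (fun y => N * C.m y) (Ico t r) r :=
      (((C.continuousOn_m r hr).mono (Ico_subset_Icc_self.trans hsub)).const_mul N :)
    have hne : (𝓝[Ico t r] r).NeBot := by
      rw [← mem_closure_iff_nhdsWithin_neBot, closure_Ico htr.ne]
      exact right_mem_Icc.2 htr.le
    obtain ⟨y, h1, h2⟩ := ((hc.eventually (lt_mem_nhds hS)).and self_mem_nhdsWithin).exists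
    exact ⟨y, hsub (Ico_subset_Icc_self h2), h2.2, h1⟩
  have hpos : 0 < (r - y) * (N * C.m y - S) := mul_pos (by linarith) (by linarith)
  filter_upwards [hmax y hy _ hpos] with j hj
  by_contra! hrx
  have h1 : C.gain N S (x j) t ≤ _ := gain_le hr (hx j) hN
  have h2 : C.gain N S r t ≤ _ := gain_le hy hr hN
  have h3 := mul_nonneg (sub_nonneg.2 hrx) (sub_nonneg.2 hS.le)
  linarith

open Classical in
/-- A point to the right of `t` with divergence `d` from `t` (the point `t` if there is none). -/
def levelPoint (C : ConvexPotential) (t d : ℝ) : ℝ :=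
  -- The default `t` keeps the point in the domain even if the level is not attained.
  if h : ∃ r ∈ C.J, t ≤ r ∧ C.div r t = d then h.choose else t

lemma levelPoint_mem (ht : t ∈ C.J) (d : ℝ) : C.levelPoint t d ∈ C.J := by
  unfold levelPoint
  split_ifs with h
  · exact h.choose_spec.1
  · exact ht

/-- If the slope at the level point is nonnegative, `mul_div_le_gain` applies. If it is negative,
the sequence is eventually left of that point, where divergences to the right of `t` are at most
`d`. If the level is missing, the intermediate value theorem excludes larger divergences. -/
lemma eventually_mul_le_gain {x : ℕ → ℝ} {d : ℝ} (ht : t ∈ C.J) (hN : 0 ≤ N) (hd : 0 < d)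
    (hx : ∀ j, x j ∈ C.J)
    (hmax : ∀ y ∈ C.J, ∀ ε > 0, ∀ᶠ j in atTop, C.gain N S y t - ε < C.gain N S (x j) t) :
    ∀ᶠ j in atTop, t ≤ x j → d < C.div (x j) t → N * d ≤ C.gain N S (C.levelPoint t d) t := by
  by_cases h : ∃ r ∈ C.J, t ≤ r ∧ C.div r t = d
  · have hl : C.levelPoint t d = h.choose := dif_pos h
    obtain ⟨hr, htr, hrd⟩ := h.choose_spec
    rw [← hl] at hr htr hrd
    have htr' : t < C.levelPoint t d := by
      refine htr.lt_of_ne fun heq => hd.ne ?_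
      rw [← hrd, ← heq]
      simp [div]
    rcases le_or_gt (N * C.m (C.levelPoint t d)) S with hS | hS
    · refine Eventually.of_forall fun j _ _ => ?_
      have := mul_div_le_gain htr hS
      rwa [hrd] at this
    · filter_upwards [eventually_lt_of_slope ht hr htr' hN hS hx hmax] with j hj htx hdx
      have := div_mono (hx j) hr htx hj.le
      linarith
  · refine Eventually.of_forall fun j htx hdx => (h ?_).elim
    exact exists_div_eq ht (hx j) htx hd.le hdx.le

/-- A point with divergence `d` from `t`, to the right or to the left of `t` (the point `t` if there
is none). -/
def sidePoint (C : ConvexPotential) (t d : ℝ) (right : Bool) : ℝ :=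
  if right then C.levelPoint t d else -C.reflect.levelPoint (-t) d

lemma sidePoint_mem (ht : t ∈ C.J) (d : ℝ) (b : Bool) : C.sidePoint t d b ∈ C.J := by
  cases b
  · exact levelPoint_mem (C := C.reflect) (t := -t) (by simpa [reflect] using ht) d
  · exact levelPoint_mem ht d

lemma reflect_maximizing {x : ℕ → ℝ}
    (hmax : ∀ y ∈ C.J, ∀ ε > 0, ∀ᶠ j in atTop, C.gain N S y t - ε < C.gain N S (x j) t) :
    ∀ y ∈ C.reflect.J, ∀ ε > 0, ∀ᶠ j in atTop,
      C.reflect.gain N (-S) y (-t) - ε < C.reflect.gain N (-S) (-x j) (-t) := by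
  intro y hy ε hε
  filter_upwards [hmax (-y) hy ε hε] with j hj
  rw [← gain_reflect, ← gain_reflect C N S (x j) t, neg_neg] at hj
  exact hj

lemma eventually_exists_sidePoint {x : ℕ → ℝ} {d : ℝ} (ht : t ∈ C.J) (hN : 0 ≤ N) (hd : 0 < d)
    (hx : ∀ j, x j ∈ C.J)
    (hmax : ∀ y ∈ C.J, ∀ ε > 0, ∀ᶠ j in atTop, C.gain N S y t - ε < C.gain N S (x j) t) :
    ∀ᶠ j in atTop, d < C.div (x j) t → ∃ b, N * d ≤ C.gain N S (C.sidePoint t d b) t := by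
  have h1 := eventually_mul_le_gain (S := S) ht hN hd hx hmax
  have h2 := eventually_mul_le_gain (C := C.reflect) (S := -S) (t := -t) (x := fun j => -x j)
    (by simpa [reflect] using ht) hN hd (fun j => by simpa [reflect] using hx j)
    (reflect_maximizing hmax)
  filter_upwards [h1, h2] with j h1 h2 hdx
  rcases le_total t (x j) with h | h
  · exact ⟨true, h1 h hdx⟩
  · refine ⟨false, ?_⟩
    have := h2 (neg_le_neg h) (by rwa [div_reflect])
    rw [← gain_reflect]
    simpa [sidePoint] using this

/-- If the gain is unbounded to the right of `t`, then the domain is unbounded there and the gain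
tends to infinity. -/
lemma tendsto_gain_right (ht : t ∈ C.J) (hN : 0 ≤ N)
    (h : ∀ c, ∃ s ∈ C.J, t ≤ s ∧ c < C.gain N S s t) :
    (∀ i : ℕ, t + i ∈ C.J) ∧ Tendsto (fun i : ℕ => C.gain N S (t + i) t) atTop atTop := by
  -- The tangent at `t` bounds the gain on `[t, b]`, so sufficiently large values occur beyond `b`.
  have hfar : ∀ b c, t ≤ b → ∃ s ∈ C.J, b ≤ s ∧ c < C.gain N S s t := by
    intro b c hb
    obtain ⟨s, hs, hts, hc⟩ := h (max c ((b - t) * |S - N * C.m t|))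
    refine ⟨s, hs, ?_, (le_max_left _ _).trans_lt hc⟩
    by_contra! hsb
    have h1 := gain_le (S := S) (t := t) ht hs hN
    rw [gain_self] at h1
    have h2 : (s - t) * (S - N * C.m t) ≤ (b - t) * |S - N * C.m t| :=
      calc (s - t) * (S - N * C.m t) ≤ (s - t) * |S - N * C.m t| :=
            mul_le_mul_of_nonneg_left (le_abs_self _) (sub_nonneg.2 hts)
        _ ≤ _ := mul_le_mul_of_nonneg_right (by linarith) (abs_nonneg _)
    have := le_max_right c ((b - t) * |S - N * C.m t|)
    linarith
  have hmem : ∀ b, t ≤ b → b ∈ C.J := by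
    intro b hb
    obtain ⟨s, hs, hbs, -⟩ := hfar b 0 hb
    exact C.convex_J.ordConnected.out ht hs ⟨hb, hbs⟩
  refine ⟨fun i => hmem _ (by simp), tendsto_atTop.2 fun c => ?_⟩
  obtain ⟨s, hs, hts, hcs⟩ := h c
  obtain ⟨i₀, hi₀⟩ := exists_nat_ge (s - t)
  filter_upwards [eventually_ge_atTop i₀] with i hi
  have hi' : (i₀ : ℝ) ≤ i := by exact_mod_cast hi
  have hti : t ≤ t + i := by simp
  obtain ⟨s', hs', hle', hc'⟩ := hfar (t + i) c hti
  have h1 := gain_le (S := S) (t := t) (hmem _ hti) hs hN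
  have h2 := gain_le (S := S) (t := t) (hmem _ hti) hs' hN
  -- The points `s` and `s'` lie on either side of `t + i`, both with gain above `c`; the tangent at
  -- `t + i` bounds one of their gains by the gain there.
  rcases le_total 0 (S - N * C.m (t + i)) with h0 | h0
  · have := mul_nonpos_of_nonpos_of_nonneg (show s - (t + i) ≤ 0 by linarith) h0
    linarith
  · have := mul_nonpos_of_nonneg_of_nonpos (sub_nonneg.2 hle') h0
    linarith

/-- Reduces unboundedness over a continuum of parameters to two fixed sequences, to which Fatou's
lemma can be applied. -/
lemma tendsto_gain_of_unbounded (ht : t ∈ C.J) (hN : 0 ≤ N)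
    (h : ∀ c, ∃ s ∈ C.J, c < C.gain N S s t) :
    ((∀ i : ℕ, t + i ∈ C.J) ∧ Tendsto (fun i : ℕ => C.gain N S (t + i) t) atTop atTop) ∨
    ((∀ i : ℕ, t - i ∈ C.J) ∧ Tendsto (fun i : ℕ => C.gain N S (t - i) t) atTop atTop) := by
  by_cases hr : ∀ c, ∃ s ∈ C.J, t ≤ s ∧ c < C.gain N S s t
  · exact Or.inl (tendsto_gain_right ht hN hr)
  right
  push Not at hr
  obtain ⟨c₀, hc₀⟩ := hr
  have hl : ∀ c, ∃ s ∈ C.reflect.J, -t ≤ s ∧ c < C.reflect.gain N (-S) s (-t) := by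
    intro c
    obtain ⟨s, hs, hc⟩ := h (max c c₀)
    refine ⟨-s, by simpa [reflect] using hs, ?_, ?_⟩
    · by_contra! hlt
      have := hc₀ s hs (by linarith)
      have := le_max_right c c₀
      linarith
    · rw [gain_reflect]
      exact (le_max_left _ _).trans_lt hc
  obtain ⟨h1, h2⟩ := tendsto_gain_right (C := C.reflect) (by simpa [reflect] using ht) hN hl
  have heq : ∀ i : ℕ, -t + (i : ℝ) = -(t - i) := fun i => by ring
  simp only [heq, gain_reflect] at h1 h2
  exact ⟨fun i => by simpa [reflect] using h1 i, h2⟩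

end ConvexPotential

/-- Take the first level below `d`: either it is β, or the preceding level is at least `d`. -/
lemma exists_geometric_level {β a δ d : ℝ} {m : ℕ} (hβ : 0 < β) (ha : 0 < a) (ha1 : a < 1)
    (hm : β * a ^ m ≤ δ) (hd : δ < d) :
    ∃ i ≤ m, β * a ^ i < d ∧ a * min β d ≤ β * a ^ i := by
  classical
  have hex : ∃ i, β * a ^ i < d := ⟨m, hm.trans_lt hd⟩
  refine ⟨Nat.find hex, Nat.find_min' hex (hm.trans_lt hd), Nat.find_spec hex, ?_⟩
  rcases h : Nat.find hex with _ | i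
  · rw [pow_zero, mul_one]
    calc a * min β d ≤ a * β := mul_le_mul_of_nonneg_left (min_le_left _ _) ha.le
      _ ≤ β := mul_le_of_le_one_left hβ.le ha1.le
  · have h1 : d ≤ β * a ^ i := not_lt.1 (Nat.find_min hex (h ▸ Nat.lt_succ_self i))
    calc a * min β d ≤ a * (β * a ^ i) :=
          mul_le_mul_of_nonneg_left ((min_le_right _ _).trans h1) ha.le
      _ = β * a ^ (i + 1) := by ring

/-- The log-partition function of an exponential family as a convex potential. -/
def ExpFamily.potential {ν : Measure ℝ} (F : ExpFamily ν) : ConvexPotential where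
  J := F.Ψ
  φ := F.logPartition
  m := F.mean
  convex_J := F.convex_Ψ
  continuousOn_φ := F.continuousOn_logPartition
  continuousOn_m := F.continuousOn_mean
  tangent_le _ hr _ hs := ExpFamily.tangent_le hr hs

lemma ExpFamily.kl_eq_div {ν : Measure ℝ} {F : ExpFamily ν} {s : ℝ} (hs : s ∈ F.Ψ) (t : ℝ) :
    F.kl s t = F.potential.div s t :=
  ExpFamily.kl_eq hs t

/-! ### Measurability and splitting by control -/

section History

variable {Ω 𝒰 : Type*} {ν : Measure ℝ} [MeasurableSpace 𝒰] {U : ℕ → Ω → 𝒰} {Y : ℕ → Ω → ℝ}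

lemma comap_le_history {k n : ℕ} (hk : k ∈ Finset.Icc 1 n) :
    MeasurableSpace.comap (U k) inferInstance ⊔ MeasurableSpace.comap (Y k) inferInstance ≤
      history U Y n :=
  le_iSup₂_of_le k hk le_rfl

lemma measurable_control_history {k n : ℕ} (hk : k ∈ Finset.Icc 1 n) :
    Measurable[history U Y n] (U k) :=
  measurable_iff_comap_le.2 (le_sup_left.trans (comap_le_history hk))

lemma measurable_observation_history {k n : ℕ} (hk : k ∈ Finset.Icc 1 n) :
    Measurable[history U Y n] (Y k) :=
  measurable_iff_comap_le.2 (le_sup_right.trans (comap_le_history hk))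

end History

section Measurability

variable {α 𝒰 : Type*} {ν : Measure ℝ} [MeasurableSpace 𝒰] [DiscreteMeasurableSpace 𝒰]

lemma measurable_ratio_control [Countable 𝒰] {m : MeasurableSpace α} {F : 𝒰 → ExpFamily ν} {s t : 𝒰 → ℝ}
    {V : α → 𝒰} {Z : α → ℝ} (hV : Measurable V) (hZ : Measurable Z) :
    Measurable fun ω => ENNReal.ofReal ((F (V ω)).ratio (s (V ω)) (t (V ω)) (Z ω)) := by
  have h : Measurable fun p : 𝒰 × ℝ => ENNReal.ofReal ((F p.1).ratio (s p.1) (t p.1) p.2) :=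
    measurable_from_prod_countable_right fun u =>
      show Measurable fun y => ENNReal.ofReal ((F u).ratio (s u) (t u) y) from
        ((F u).measurable_ratio _ _).ennreal_ofReal
  exact h.comp (hV.prodMk hZ)

/-- A partition by finitely many controls splits a Lebesgue integral. -/
lemma lintegral_eq_sum_controls [Fintype 𝒰] [MeasurableSpace α] {P : Measure α} {V : α → 𝒰}
    (hV : Measurable V) (f : α → ENNReal) :
    ∫⁻ ω, f ω ∂P = ∑ u, ∫⁻ ω in V ⁻¹' {u}, f ω ∂P := by
  rw [← lintegral_biUnion_finset (s := Finset.univ) (t := fun u => V ⁻¹' {u})]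
  · rw [show (⋃ u ∈ (Finset.univ : Finset 𝒰), V ⁻¹' {u}) = univ by ext; simp, setLIntegral_univ]
  · intro u _ v _ huv
    exact Disjoint.preimage _ (by simpa using huv)
  · exact fun u _ => hV MeasurableSet.of_discrete

end Measurability

/-! ### Log-likelihood ratios by control -/

section LogRatio

variable {Ω 𝒰 : Type*} {ν : Measure ℝ} [DecidableEq 𝒰] {F : 𝒰 → ExpFamily ν} {θ : 𝒰 → ℝ}
  {U : ℕ → Ω → 𝒰} {Y : ℕ → Ω → ℝ}

variable (F U Y) in
/-- The sum of the statistics of the observations made under control `u` up to time `n`. -/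
def sumStatistic (u : 𝒰) (n : ℕ) (ω : Ω) : ℝ :=
  ∑ k ∈ (Finset.Icc 1 n).filter (fun k => U k ω = u), (F u).T (Y k ω)

variable (F θ U Y) in
/-- The log-likelihood ratio of `s` to `θ u` in the observations made under control `u`. -/
def logRatio (n : ℕ) (u : 𝒰) (s : ℝ) (ω : Ω) : ℝ :=
  (F u).potential.gain (count U u n ω) (sumStatistic F U Y u n ω) s (θ u)

lemma exp_logRatio (n : ℕ) (u : 𝒰) (s : ℝ) (ω : Ω) :
    Real.exp (logRatio F θ U Y n u s ω) =
      ∏ k ∈ (Finset.Icc 1 n).filter (fun k => U k ω = u), (F u).ratio s (θ u) (Y k ω) := by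
  simp only [ExpFamily.ratio, ← Real.exp_sum, Finset.sum_sub_distrib, ← Finset.mul_sum,
    Finset.sum_const, nsmul_eq_mul, logRatio, ConvexPotential.gain, ExpFamily.potential,
    sumStatistic, count, mul_sub]

/-- Regrouping factors from controls to times allows induction on time. -/
lemma prod_exp_logRatio [Fintype 𝒰] (n : ℕ) (s : 𝒰 → ℝ) (ω : Ω) :
    ∏ u, ENNReal.ofReal (Real.exp (logRatio F θ U Y n u (s u) ω)) =
      ∏ k ∈ Finset.Icc 1 n,
        ENNReal.ofReal ((F (U k ω)).ratio (s (U k ω)) (θ (U k ω)) (Y k ω)) := by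
  rw [← Finset.prod_fiberwise (Finset.Icc 1 n) (fun k => U k ω)]
  refine Finset.prod_congr rfl fun u _ => ?_
  rw [exp_logRatio, ENNReal.ofReal_prod_of_nonneg (f := fun k => (F u).ratio (s u) (θ u) (Y k ω))
    fun k _ => (Real.exp_pos _).le]
  refine Finset.prod_congr rfl fun k hk => ?_
  rw [(Finset.mem_filter.1 hk).2]

end LogRatio

/-! ### Expectations of likelihood ratios under adaptive sampling -/

section Sampling

variable {Ω 𝒰 : Type*} {ν : Measure ℝ} [MeasurableSpace Ω] [MeasurableSpace 𝒰]
  {F : 𝒰 → ExpFamily ν} {θ : 𝒰 → ℝ} {U : ℕ → Ω → 𝒰} {Y : ℕ → Ω → ℝ} {P : Measure Ω}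

lemma IsControlledProcess.history_le (hP : IsControlledProcess F θ U Y P) (n : ℕ) :
    history U Y n ≤ (inferInstance : MeasurableSpace Ω) :=
  iSup₂_le fun k hk => sup_le
    (measurable_iff_comap_le.1 (hP.measurable_U k (Finset.mem_Icc.1 hk).1))
    (measurable_iff_comap_le.1 (hP.measurable_Y k (Finset.mem_Icc.1 hk).1))

variable [DiscreteMeasurableSpace 𝒰]

lemma IsControlledProcess.measurable_logRatio [DecidableEq 𝒰] (hP : IsControlledProcess F θ U Y P) (n : ℕ) (u : 𝒰)
    (s : ℝ) : Measurable (logRatio F θ U Y n u s) := by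
  have hU : ∀ k ∈ Finset.Icc 1 n, MeasurableSet {ω | U k ω = u} := fun k hk =>
    hP.measurable_U k (Finset.mem_Icc.1 hk).1 (MeasurableSet.of_discrete (s := ({u} : Set 𝒰)))
  have h1 : Measurable fun ω => (count U u n ω : ℝ) := by
    simp only [count, Finset.card_filter, Nat.cast_sum]
    exact Finset.measurable_fun_sum _ fun k hk =>
      measurable_from_nat.comp (Measurable.ite (hU k hk) measurable_const measurable_const)
  have h2 : Measurable (sumStatistic F U Y u n) := by
    unfold sumStatistic
    simp only [Finset.sum_filter]
    exact Finset.measurable_fun_sum _ fun k hk => Measurable.ite (hU k hk)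
      ((F u).measurable_T.comp (hP.measurable_Y k (Finset.mem_Icc.1 hk).1)) measurable_const
  unfold logRatio ConvexPotential.gain
  fun_prop

variable [IsProbabilityMeasure P]

/-- Where the predictable control equals `u`, the conditional law of the observation is constant, so
the probability factorizes. -/
lemma IsControlledProcess.measure_inter (hP : IsControlledProcess F θ U Y P)
    (hθ : θ ∈ paramDomain F) {k : ℕ} (hk : 1 ≤ k) {C : Set Ω}
    (hC : MeasurableSet[history U Y (k - 1)] C) (u : 𝒰) {B : Set ℝ} (hB : MeasurableSet B) :
    P (C ∩ U k ⁻¹' {u} ∩ Y k ⁻¹' B) = P (C ∩ U k ⁻¹' {u}) * (F u).law (θ u) B := by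
  have hle := hP.history_le (k - 1)
  have hYB : MeasurableSet (Y k ⁻¹' B) := hP.measurable_Y k hk hB
  have hCu : MeasurableSet[history U Y (k - 1)] (C ∩ U k ⁻¹' {u}) :=
    hC.inter (hP.predictable_U k hk (MeasurableSet.of_discrete (s := ({u} : Set 𝒰))))
  have := ExpFamily.isProbabilityMeasure_law (hθ u)
  have h1 := setIntegral_condExp hle (f := (Y k ⁻¹' B).indicator fun _ => (1 : ℝ)) (μ := P)
    ((integrable_const 1).indicator hYB) hCu
  rw [setIntegral_congr_ae (g := fun _ => ((F u).law (θ u)).real B) (hle _ hCu), setIntegral_const,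
    setIntegral_indicator hYB, setIntegral_const, smul_eq_mul, smul_eq_mul, mul_one] at h1
  · rw [← ENNReal.toReal_eq_toReal_iff' (measure_ne_top _ _)
      (ENNReal.mul_ne_top (measure_ne_top _ _) (measure_ne_top _ _)), ENNReal.toReal_mul]
    exact h1.symm
  · filter_upwards [hP.condLaw_Y k hk B hB] with ω hω hmem
    have hu : U k ω = u := hmem.2
    rw [hω, hu]

lemma IsControlledProcess.setLIntegral_mul (hP : IsControlledProcess F θ U Y P)
    (hθ : θ ∈ paramDomain F) {k : ℕ} (hk : 1 ≤ k) {f : Ω → ENNReal}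
    (hf : Measurable[history U Y (k - 1)] f) (u : 𝒰) {g : ℝ → ENNReal} (hg : Measurable g)
    (hg1 : ∫⁻ y, g y ∂(F u).law (θ u) = 1) :
    ∫⁻ ω in U k ⁻¹' {u}, f ω * g (Y k ω) ∂P = ∫⁻ ω in U k ⁻¹' {u}, f ω ∂P := by
  have hle := hP.history_le (k - 1)
  have hY := hP.measurable_Y k hk
  set Q := P.restrict (U k ⁻¹' {u}) with hQ
  have hgY : Measurable fun ω => g (Y k ω) := hg.comp hY
  -- Reweighting by `g (Y k)` leaves the measure unchanged on the past, so it preserves integrals of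
  -- every past-measurable `f`, without integrability.
  have htrim : (Q.withDensity fun ω => g (Y k ω)).trim hle = Q.trim hle := by
    refine @Measure.ext _ (history U Y (k - 1)) _ _ fun C hC => ?_
    have hC' := hle _ hC
    rw [trim_measurableSet_eq hle hC, trim_measurableSet_eq hle hC, withDensity_apply _ hC', hQ,
      Measure.restrict_restrict hC']
    have hmap : (P.restrict (C ∩ U k ⁻¹' {u})).map (Y k) =
        P (C ∩ U k ⁻¹' {u}) • (F u).law (θ u) := by
      ext B hB
      rw [Measure.map_apply hY hB, Measure.restrict_apply (hY hB), inter_comm,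
        hP.measure_inter hθ hk hC u hB, Measure.smul_apply, smul_eq_mul]
    rw [← lintegral_map hg hY, hmap, lintegral_smul_measure, hg1, smul_eq_mul, mul_one,
      Measure.restrict_apply hC']
  calc ∫⁻ ω, f ω * g (Y k ω) ∂Q = ∫⁻ ω, f ω ∂(Q.withDensity fun ω => g (Y k ω)) := by
        rw [lintegral_withDensity_eq_lintegral_mul _ hgY (hf.mono hle le_rfl)]
        simp only [Pi.mul_apply, mul_comm]
    _ = ∫⁻ ω, f ω ∂Q := by
        rw [← lintegral_trim hle hf, htrim, lintegral_trim hle hf]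

variable [Fintype 𝒰]

/-- The likelihood ratios of two parameter vectors have expectation one. -/
lemma IsControlledProcess.lintegral_prod_ratio (hP : IsControlledProcess F θ U Y P)
    (hθ : θ ∈ paramDomain F) {s : 𝒰 → ℝ} (hs : s ∈ paramDomain F) (n : ℕ) :
    ∫⁻ ω, ∏ k ∈ Finset.Icc 1 n,
      ENNReal.ofReal ((F (U k ω)).ratio (s (U k ω)) (θ (U k ω)) (Y k ω)) ∂P = 1 := by
  induction n with
  | zero => simp
  | succ n ih =>
    simp_rw [Finset.prod_Icc_succ_top (Nat.le_add_left 1 n)]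
    rw [← ih]
    have hk : 1 ≤ n + 1 := Nat.le_add_left 1 n
    rw [lintegral_eq_sum_controls (hP.measurable_U (n + 1) hk),
      lintegral_eq_sum_controls (hP.measurable_U (n + 1) hk)]
    refine Finset.sum_congr rfl fun u _ => ?_
    have hf : Measurable[history U Y n] fun ω => ∏ k ∈ Finset.Icc 1 n,
        ENNReal.ofReal ((F (U k ω)).ratio (s (U k ω)) (θ (U k ω)) (Y k ω)) :=
      Finset.measurable_fun_prod _ fun k hk' => measurable_ratio_control
        (measurable_control_history hk') (measurable_observation_history hk')
    rw [← hP.setLIntegral_mul hθ hk (u := u)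
      (g := fun y => ENNReal.ofReal ((F u).ratio (s u) (θ u) y)) hf
      ((F u).measurable_ratio _ _).ennreal_ofReal (ExpFamily.lintegral_ratio (hs u) _)]
    refine setLIntegral_congr_fun (hP.measurable_U (n + 1) hk MeasurableSet.of_discrete) ?_
    intro ω hω
    have hu : U (n + 1) ω = u := hω
    simp only [hu]

/-- Makes the likelihood positive almost surely, so that it can be divided out. -/
lemma IsControlledProcess.ae_carrier_ne_zero (hP : IsControlledProcess F θ U Y P)
    (hθ : θ ∈ paramDomain F) (n : ℕ) :
    ∀ᵐ ω ∂P, ∀ k ∈ Finset.Icc 1 n, (F (U k ω)).h (Y k ω) ≠ 0 := by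
  rw [Finset.eventually_all]
  intro k hk
  have h : ∀ u, ∀ᵐ ω ∂P, ¬(U k ω = u ∧ (F u).h (Y k ω) = 0) := by
    intro u
    rw [ae_iff]
    have := hP.measure_inter hθ (Finset.mem_Icc.1 hk).1 (C := univ) MeasurableSet.univ u
      ((F u).measurable_h (measurableSet_singleton 0))
    rw [show (F u).h ⁻¹' {0} = {y | (F u).h y = 0} from rfl, ExpFamily.law_carrier_zero,
      mul_zero, univ_inter] at this
    simp only [not_not]
    exact this
  filter_upwards [ae_all_iff.2 h] with ω hω h0
  exact hω (U k ω) ⟨rfl, h0⟩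

variable [DecidableEq 𝒰]

lemma IsControlledProcess.lintegral_prod_exp_logRatio (hP : IsControlledProcess F θ U Y P)
    (hθ : θ ∈ paramDomain F) {s : 𝒰 → ℝ} (hs : s ∈ paramDomain F) (n : ℕ) :
    ∫⁻ ω, ∏ u, ENNReal.ofReal (Real.exp (logRatio F θ U Y n u (s u) ω)) ∂P = 1 := by
  simp_rw [prod_exp_logRatio]
  exact hP.lintegral_prod_ratio hθ hs n

/-- Keeping the other coordinates at `θ` makes their factors one. -/
lemma IsControlledProcess.lintegral_exp_logRatio (hP : IsControlledProcess F θ U Y P)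
    (hθ : θ ∈ paramDomain F) {u : 𝒰} {s : ℝ} (hs : s ∈ (F u).Ψ) (n : ℕ) :
    ∫⁻ ω, ENNReal.ofReal (Real.exp (logRatio F θ U Y n u s ω)) ∂P = 1 := by
  rw [← hP.lintegral_prod_exp_logRatio hθ (s := Function.update θ u s) _ n]
  · refine lintegral_congr fun ω => ?_
    rw [Finset.prod_eq_single u]
    · simp
    · intro v _ hv
      simp [hv, logRatio, ConvexPotential.gain_self]
    · simp
  · intro v
    by_cases hv : v = u
    · subst hv
      simpa using hs
    · simpa [hv] using hθ v

/-- By Fatou, the lower limit of variables of expectation one is almost surely finite. -/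
lemma IsControlledProcess.ae_not_tendsto (hP : IsControlledProcess F θ U Y P)
    (hθ : θ ∈ paramDomain F) {u : 𝒰} {x : ℕ → ℝ} (hx : ∀ i, x i ∈ (F u).Ψ) (n : ℕ) :
    ∀ᵐ ω ∂P, ¬Tendsto (fun i => logRatio F θ U Y n u (x i) ω) atTop atTop := by
  have hm : ∀ i, Measurable fun ω => ENNReal.ofReal (Real.exp (logRatio F θ U Y n u (x i) ω)) :=
    fun i => (hP.measurable_logRatio n u (x i)).exp.ennreal_ofReal
  have h1 := lintegral_liminf_le (μ := P) (u := atTop) hm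
  simp only [hP.lintegral_exp_logRatio hθ (hx _), liminf_const] at h1
  have hl : Measurable fun ω => liminf
      (fun i => ENNReal.ofReal (Real.exp (logRatio F θ U Y n u (x i) ω))) atTop :=
    Measurable.liminf hm
  filter_upwards [ae_lt_top hl (h1.trans_lt ENNReal.one_lt_top).ne] with ω hω htend
  exact hω.ne (ENNReal.tendsto_ofReal_atTop.comp (Real.tendsto_exp_atTop.comp htend)).liminf_eq

lemma IsControlledProcess.ae_bddAbove_logRatio (hP : IsControlledProcess F θ U Y P)
    (hθ : θ ∈ paramDomain F) (n : ℕ) :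
    ∀ᵐ ω ∂P, ∀ u, ∃ c, ∀ s ∈ (F u).Ψ, logRatio F θ U Y n u s ω ≤ c := by
  rw [ae_all_iff]
  intro u
  have key : ∀ x : ℕ → ℝ, ∀ᵐ ω ∂P,
      ¬((∀ i, x i ∈ (F u).Ψ) ∧ Tendsto (fun i => logRatio F θ U Y n u (x i) ω) atTop atTop) := by
    intro x
    by_cases hx : ∀ i, x i ∈ (F u).Ψ
    · filter_upwards [hP.ae_not_tendsto hθ hx n] with ω hω h
      exact hω h.2
    · exact Eventually.of_forall fun ω h => hx h.1
  filter_upwards [key fun i => θ u + i, key fun i => θ u - i] with ω h1 h2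
  by_contra! h
  rcases ConvexPotential.tendsto_gain_of_unbounded (C := (F u).potential)
    (S := sumStatistic F U Y u n ω) (hθ u) (Nat.cast_nonneg (count U u n ω)) h with h3 | h3
  · exact h1 h3
  · exact h2 h3

end Sampling

/-! ### Separation of coordinates and the parameter grid -/

/-- A sequence that maximizes a sum of bounded functions of separate coordinates maximizes each of
the functions. -/
lemma maximizing_coordinate {ι : Type*} [Fintype ι] {J : ι → Set ℝ} {g : ι → ℝ → ℝ}
    {x : ℕ → ι → ℝ} (hbdd : ∀ i, ∃ c, ∀ s ∈ J i, g i s ≤ c) (hx : ∀ j i, x j i ∈ J i)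
    (hmax : ∀ y : ι → ℝ, (∀ i, y i ∈ J i) → ∀ ε > 0, ∀ᶠ j in atTop,
      ∑ i, g i (y i) - ε < ∑ i, g i (x j i)) (i : ι) :
    ∀ y ∈ J i, ∀ ε > 0, ∀ᶠ j in atTop, g i y - ε < g i (x j i) := by
  classical
  intro y hy ε hε
  set δ := ε / (2 * (Fintype.card ι + 1)) with hδ
  have hδ0 : 0 < δ := by positivity
  -- Near-maximizers in the other coordinates leave the sequence a total advantage there of at most
  -- ε/2; boundedness above is what provides them.
  have hw : ∀ v, ∃ w ∈ J v, ∀ s ∈ J v, g v s ≤ g v w + δ := by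
    intro v
    obtain ⟨c, hc⟩ := hbdd v
    have hb : BddAbove (g v '' J v) := ⟨c, by rintro _ ⟨s, hs, rfl⟩; exact hc s hs⟩
    obtain ⟨_, ⟨w, hw, rfl⟩, hlt⟩ := exists_lt_of_lt_csSup
      (⟨_, mem_image_of_mem _ (hx 0 v)⟩ : (g v '' J v).Nonempty) (sub_lt_self (sSup (g v '' J v)) hδ0)
    refine ⟨w, hw, fun s hs => ?_⟩
    have := le_csSup hb (mem_image_of_mem _ hs)
    linarith
  choose w hwJ hw using hw
  have hz : ∀ v, Function.update w i y v ∈ J v := by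
    intro v
    by_cases hv : v = i
    · subst hv
      simpa using hy
    · simpa [hv] using hwJ v
  filter_upwards [hmax _ hz (ε / 2) (half_pos hε)] with j hj
  have h1 := Finset.add_sum_erase Finset.univ (fun v => g v (Function.update w i y v))
    (Finset.mem_univ i)
  have h2 := Finset.add_sum_erase Finset.univ (fun v => g v (x j v)) (Finset.mem_univ i)
  simp only [Function.update_self] at h1
  have h3 : ∑ v ∈ Finset.univ.erase i, g v (x j v) ≤
      ∑ v ∈ Finset.univ.erase i, (g v (Function.update w i y v) + δ) := by
    refine Finset.sum_le_sum fun v hv => ?_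
    rw [Function.update_of_ne (Finset.ne_of_mem_erase hv)]
    exact hw v _ (hx j v)
  have h4 : ((Finset.univ.erase i).card : ℝ) * δ ≤ ε / 2 := by
    have h5 : ((Finset.univ.erase i).card : ℝ) ≤ Fintype.card ι + 1 := by
      have : (Finset.univ.erase i).card ≤ Fintype.card ι := Finset.card_le_univ _
      have : ((Finset.univ.erase i).card : ℝ) ≤ Fintype.card ι := by exact_mod_cast this
      linarith
    calc ((Finset.univ.erase i).card : ℝ) * δ ≤ (Fintype.card ι + 1) * δ :=
          mul_le_mul_of_nonneg_right h5 hδ0.le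
      _ = ε / 2 := by
          rw [hδ]
          field_simp
  rw [Finset.sum_add_distrib, Finset.sum_const, nsmul_eq_mul] at h3
  linarith

section Grid

variable {Ω 𝒰 : Type*} {ν : Measure ℝ} {F : 𝒰 → ExpFamily ν} {θ : 𝒰 → ℝ} {U : ℕ → Ω → 𝒰}
  {Y : ℕ → Ω → ℝ} {n : ℕ} {ω : Ω}

variable (F θ) in
/-- A finite grid of parameters of the family `F u`: the parameter `θ u`, and on both sides of it
the parameters with divergences `β`, `β a`, …, `β a ^ m` from it. -/
def grid (β a : ℝ) (m : ℕ) (u : 𝒰) : Option (Bool × Fin (m + 1)) → ℝ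
  | none => θ u
  | some (b, i) => (F u).potential.sidePoint (θ u) (β * a ^ (i : ℕ)) b

lemma grid_mem (hθ : θ ∈ paramDomain F) (β a : ℝ) (m : ℕ) (u : 𝒰)
    (o : Option (Bool × Fin (m + 1))) : grid F θ β a m u o ∈ (F u).Ψ := by
  rcases o with _ | ⟨b, i⟩
  · exact hθ u
  · exact ConvexPotential.sidePoint_mem (C := (F u).potential) (hθ u) _ b

lemma count_le [DecidableEq 𝒰] (u : 𝒰) : count U u n ω ≤ n := by
  simpa [count] using Finset.card_filter_le (Finset.Icc 1 n) fun k => U k ω = u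

variable {β a ε : ℝ} {m : ℕ}

lemma eventually_exists_grid [DecidableEq 𝒰] (hθ : θ ∈ paramDomain F) (hβ : 0 < β) (ha : 0 < a) (ha1 : a < 1)
    (hε : 0 < ε) (hn : 0 < n) (hm : β * a ^ m ≤ ε / n) {u : 𝒰} {x : ℕ → ℝ}
    (hx : ∀ j, x j ∈ (F u).Ψ)
    (hmax : ∀ y ∈ (F u).Ψ, ∀ ε > 0, ∀ᶠ j in atTop,
      logRatio F θ U Y n u y ω - ε < logRatio F θ U Y n u (x j) ω) :
    ∀ᶠ j in atTop, ∃ o, a * (min (count U u n ω * (F u).kl (x j) (θ u)) β - ε) ≤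
      logRatio F θ U Y n u (grid F θ β a m u o) ω := by
  set N : ℝ := (count U u n ω : ℝ) with hN
  have hN0 : 0 ≤ N := Nat.cast_nonneg _
  have hn0 : (0 : ℝ) < n := Nat.cast_pos.2 hn
  have hNn : N ≤ n := Nat.cast_le.2 (count_le u)
  have hev : ∀ᶠ j in atTop, ∀ i : Fin (m + 1), β * a ^ (i : ℕ) < (F u).potential.div (x j) (θ u) →
      ∃ b, N * (β * a ^ (i : ℕ)) ≤ (F u).potential.gain N (sumStatistic F U Y u n ω)
        ((F u).potential.sidePoint (θ u) (β * a ^ (i : ℕ)) b) (θ u) :=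
    eventually_all.2 fun i => ConvexPotential.eventually_exists_sidePoint
      (C := (F u).potential) (hθ u) hN0 (by positivity) hx hmax
  filter_upwards [hev] with j hj
  rw [ExpFamily.kl_eq_div (hx j)]
  set d := (F u).potential.div (x j) (θ u)
  rcases le_or_gt (N * d) ε with hz | hz
  · refine ⟨none, ?_⟩
    rw [logRatio, grid, ConvexPotential.gain_self]
    exact mul_nonpos_of_nonneg_of_nonpos ha.le (by linarith [min_le_left (N * d) β])
  have hN1 : 1 ≤ N := by
    rw [hN, Nat.one_le_cast, Nat.one_le_iff_ne_zero]
    intro h0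
    rw [hN, h0, Nat.cast_zero, zero_mul] at hz
    exact hz.not_gt hε
  have hd0 : 0 < d := pos_of_mul_pos_right (hε.trans hz) hN0
  have hd : ε / n < d := by
    rw [div_lt_iff₀ hn0]
    calc ε < N * d := hz
      _ ≤ n * d := mul_le_mul_of_nonneg_right hNn hd0.le
      _ = d * n := mul_comm _ _
  obtain ⟨i, him, hid, hmin⟩ := exists_geometric_level hβ ha ha1 hm hd
  obtain ⟨b, hb⟩ := hj ⟨i, Nat.lt_succ_of_le him⟩ hid
  refine ⟨some (b, ⟨i, Nat.lt_succ_of_le him⟩), le_trans ?_ hb⟩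
  -- The cap at the top level is harmless because `N ≥ 1`: a divergence above β still yields at
  -- least β.
  have h1 : min (N * d) β ≤ N * min β d := by
    rcases le_total β d with h | h
    · rw [min_eq_left h]
      exact (min_le_right _ _).trans (le_mul_of_one_le_left hβ.le hN1)
    · rw [min_eq_right h]
      exact min_le_left _ _
  calc a * (min (N * d) β - ε) ≤ a * (N * min β d) :=
        mul_le_mul_of_nonneg_left (by linarith) ha.le
    _ = N * (a * min β d) := by ring
    _ ≤ N * (β * a ^ i) := mul_le_mul_of_nonneg_left hmin hN0

end Grid

/-! ### From a large divergence to a large grid sum -/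

section Pathwise

variable {Ω 𝒰 : Type*} {ν : Measure ℝ} [Fintype 𝒰] [DecidableEq 𝒰] {F : 𝒰 → ExpFamily ν}
  {θ : 𝒰 → ℝ} {U : ℕ → Ω → 𝒰} {Y : ℕ → Ω → ℝ} {n : ℕ} {ω : Ω}

lemma likelihood_eq_mul_exp (s : 𝒰 → ℝ) :
    likelihood F U Y n ω s =
      likelihood F U Y n ω θ * Real.exp (∑ u, logRatio F θ U Y n u (s u) ω) := by
  rw [Real.exp_sum, likelihood, likelihood, ← Finset.prod_mul_distrib]
  refine Finset.prod_congr rfl fun u _ => ?_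
  rw [exp_logRatio, ← Finset.prod_mul_distrib]
  exact Finset.prod_congr rfl fun k _ => ((F u).density_mul_exp _ _ _).symm

lemma likelihood_pos (hω : ∀ k ∈ Finset.Icc 1 n, (F (U k ω)).h (Y k ω) ≠ 0) (s : 𝒰 → ℝ) :
    0 < likelihood F U Y n ω s := by
  refine Finset.prod_pos fun u _ => Finset.prod_pos fun k hk => ?_
  obtain ⟨hk', rfl⟩ := Finset.mem_filter.1 hk
  exact mul_pos (((F _).h_nonneg _).lt_of_ne' (hω k hk')) (Real.exp_pos _)

lemma IsMLESeq.maximizing_logRatio {x : ℕ → 𝒰 → ℝ} (hx : IsMLESeq F U Y n ω x)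
    (hω : ∀ k ∈ Finset.Icc 1 n, (F (U k ω)).h (Y k ω) ≠ 0)
    (hbdd : ∀ u, ∃ c, ∀ s ∈ (F u).Ψ, logRatio F θ U Y n u s ω ≤ c) (u : 𝒰) :
    ∀ y ∈ (F u).Ψ, ∀ ε > 0, ∀ᶠ j in atTop,
      logRatio F θ U Y n u y ω - ε < logRatio F θ U Y n u (x j u) ω := by
  have hpos := likelihood_pos hω θ
  refine maximizing_coordinate (g := fun u s => logRatio F θ U Y n u s ω) hbdd hx.1
    (fun y hy ε hε => ?_) u
  have hlt : likelihood F U Y n ω θ * Real.exp (∑ u, logRatio F θ U Y n u (y u) ω - ε) <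
      likelihood F U Y n ω y := by
    rw [likelihood_eq_mul_exp (θ := θ) y]
    exact mul_lt_mul_of_pos_left (Real.exp_lt_exp.2 (by linarith)) hpos
  filter_upwards [hx.2 y hy _ hlt] with j hj
  rw [likelihood_eq_mul_exp (θ := θ) (x j)] at hj
  exact Real.exp_lt_exp.1 (lt_of_mul_lt_mul_left hj hpos.le)

variable {β a ε : ℝ} {m : ℕ}

/-- On an outcome at which the likelihood is positive and bounded, a large value of the weighted
divergence makes the sum of the likelihood ratios over the grid large. -/
lemma exp_le_prod_sum_grid [Nonempty 𝒰] (hθ : θ ∈ paramDomain F) (hβ : 0 < β) (ha : 0 < a)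
    (ha1 : a < 1) (hε : 0 < ε) (hn : 0 < n) (hm : β * a ^ m ≤ ε / n)
    (hω : ∀ k ∈ Finset.Icc 1 n, (F (U k ω)).h (Y k ω) ≠ 0)
    (hbdd : ∀ u, ∃ c, ∀ s ∈ (F u).Ψ, logRatio F θ U Y n u s ω ≤ c) {x : ℕ → 𝒰 → ℝ}
    (hx : IsMLESeq F U Y n ω x) (hW : ∀ b < β, ∀ᶠ j in atTop, b < weightedKL F U n ω (x j) θ) :
    Real.exp (a * (β - Fintype.card 𝒰 * ε)) ≤
      ∏ u, ∑ o, Real.exp (logRatio F θ U Y n u (grid F θ β a m u o) ω) := by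
  set Q := fun u => ∑ o, Real.exp (logRatio F θ U Y n u (grid F θ β a m u o) ω) with hQ
  have hQle : ∀ u o, Real.exp (logRatio F θ U Y n u (grid F θ β a m u o) ω) ≤ Q u := fun u o =>
    Finset.single_le_sum (f := fun o => Real.exp (logRatio F θ U Y n u (grid F θ β a m u o) ω))
      (fun _ _ => (Real.exp_pos _).le) (Finset.mem_univ o)
  have hQ1 : ∀ u, 1 ≤ Q u := by
    intro u
    have := hQle u none
    rwa [grid, logRatio, ConvexPotential.gain_self, Real.exp_zero] at this
  have hpos : 0 < ∏ u, Q u := Finset.prod_pos fun u _ => zero_lt_one.trans_le (hQ1 u)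
  rw [← Real.le_log_iff_exp_le hpos, ← le_div_iff₀' ha, sub_le_iff_le_add]
  -- The lower-limit condition only provides values above each `b < β`.
  refine le_of_forall_lt_imp_le_of_dense fun b hb => ?_
  rw [← sub_le_iff_le_add, le_div_iff₀' ha, Real.le_log_iff_exp_le hpos]
  have hev : ∀ᶠ j in atTop, ∀ u, ∃ o,
      a * (min (count U u n ω * (F u).kl (x j u) (θ u)) β - ε) ≤
        logRatio F θ U Y n u (grid F θ β a m u o) ω :=
    eventually_all.2 fun u => eventually_exists_grid hθ hβ ha ha1 hε hn hm (fun j => hx.1 j u)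
      (hx.maximizing_logRatio hω hbdd u)
  obtain ⟨j, hj, hbj⟩ := (hev.and (hW b hb)).exists
  set z := fun u => (count U u n ω : ℝ) * (F u).kl (x j u) (θ u) with hz
  have hle : ∀ u, Real.exp (max 0 (a * (min (z u) β - ε))) ≤ Q u := by
    intro u
    rcases max_choice 0 (a * (min (z u) β - ε)) with h | h <;> rw [h]
    · rw [Real.exp_zero]
      exact hQ1 u
    · obtain ⟨o, ho⟩ := hj u
      exact (Real.exp_le_exp.2 ho).trans (hQle u o)
  refine le_trans ?_ (Finset.prod_le_prod (fun u _ => (Real.exp_pos _).le) fun u _ => hle u)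
  rw [← Real.exp_sum, Real.exp_le_exp]
  -- A coordinate above the cap suffices alone, the other factors being at least one; otherwise no
  -- cap is active and the coordinates add up.
  by_cases hcap : ∃ u, β < z u
  · obtain ⟨u, hu⟩ := hcap
    refine le_trans ?_ (Finset.single_le_sum (fun _ _ => le_max_left _ _) (Finset.mem_univ u))
    refine le_trans ?_ (le_max_right _ _)
    rw [min_eq_right hu.le]
    refine mul_le_mul_of_nonneg_left ?_ ha.le
    have h1 : (1 : ℝ) ≤ Fintype.card 𝒰 := Nat.one_le_cast.2 Fintype.card_pos
    have := mul_le_mul_of_nonneg_right h1 hε.le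
    linarith
  · push Not at hcap
    calc a * (b - Fintype.card 𝒰 * ε) ≤ a * (∑ u, z u - Fintype.card 𝒰 * ε) :=
          mul_le_mul_of_nonneg_left (sub_le_sub_right hbj.le _) ha.le
      _ = ∑ u, a * (min (z u) β - ε) := by
          rw [← Finset.mul_sum, Finset.sum_sub_distrib, Finset.sum_const, nsmul_eq_mul,
            Finset.card_univ]
          simp only [min_eq_left (hcap _)]
      _ ≤ _ := Finset.sum_le_sum fun u _ => le_max_right _ _

end Pathwise

/-! ### Markov's inequality for the grid mixture -/

section Deviation

variable {Ω 𝒰 : Type*} {ν : Measure ℝ} [MeasurableSpace Ω] [Fintype 𝒰] [DecidableEq 𝒰]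
  [MeasurableSpace 𝒰] [DiscreteMeasurableSpace 𝒰] {F : 𝒰 → ExpFamily ν} {θ : 𝒰 → ℝ}
  {U : ℕ → Ω → 𝒰} {Y : ℕ → Ω → ℝ} {P : Measure Ω} [IsProbabilityMeasure P]

/-- Expanding the product gives one joint likelihood ratio per choice of grid points, so no
independence between controls is needed. -/
lemma IsControlledProcess.lintegral_prod_sum (hP : IsControlledProcess F θ U Y P)
    (hθ : θ ∈ paramDomain F) {α : Type*} [Fintype α] {τ : 𝒰 → α → ℝ}
    (hτ : ∀ u o, τ u o ∈ (F u).Ψ) (n : ℕ) :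
    ∫⁻ ω, ∏ u, ∑ o, ENNReal.ofReal (Real.exp (logRatio F θ U Y n u (τ u o) ω)) ∂P =
      (Fintype.card α : ENNReal) ^ Fintype.card 𝒰 := by
  simp_rw [Finset.prod_univ_sum]
  rw [lintegral_finsetSum]
  · rw [Finset.sum_congr rfl fun p _ =>
      hP.lintegral_prod_exp_logRatio hθ (s := fun u => τ u (p u)) (fun u => hτ u _) n]
    simp
  · exact fun p _ => Finset.measurable_fun_prod _ fun u _ =>
      (hP.measurable_logRatio n u _).exp.ennreal_ofReal

/-- The deviation inequality with free parameters `a`, `ε` and `m`. -/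
lemma IsControlledProcess.measureReal_le (hP : IsControlledProcess F θ U Y P)
    (hθ : θ ∈ paramDomain F) {β a ε : ℝ} {m n : ℕ} (hβ : 0 < β) (ha : 0 < a) (ha1 : a < 1)
    (hε : 0 < ε) (hn : 0 < n) (hm : β * a ^ m ≤ ε / n) :
    P.real {ω | ∃ x : ℕ → 𝒰 → ℝ, IsMLESeq F U Y n ω x ∧
        ∀ b < β, ∀ᶠ j in atTop, b < weightedKL F U n ω (x j) θ} ≤
      (2 * m + 3 : ℝ) ^ Fintype.card 𝒰 * Real.exp (-(a * (β - Fintype.card 𝒰 * ε))) := by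
  have : Nonempty Ω := nonempty_of_isProbabilityMeasure P
  have : Nonempty 𝒰 := ⟨U 1 (Classical.arbitrary Ω)⟩
  set c := Real.exp (a * (β - Fintype.card 𝒰 * ε)) with hc
  set M : Ω → ENNReal := fun ω =>
    ∏ u, ∑ o, ENNReal.ofReal (Real.exp (logRatio F θ U Y n u (grid F θ β a m u o) ω)) with hM
  have hMm : Measurable M := Finset.measurable_fun_prod _ fun u _ =>
    Finset.measurable_fun_sum _ fun o _ => (hP.measurable_logRatio n u _).exp.ennreal_ofReal
  have hint : ∫⁻ ω, M ω ∂P = (2 * m + 3 : ENNReal) ^ Fintype.card 𝒰 := by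
    rw [hP.lintegral_prod_sum hθ (grid_mem hθ β a m) n]
    congr 1
    simp only [Fintype.card_option, Fintype.card_prod, Fintype.card_bool, Fintype.card_fin]
    push_cast
    ring
  -- The event on the left is not shown to be measurable; the measurable `M` covers it up to a null
  -- set.
  have hsub : P {ω | ∃ x : ℕ → 𝒰 → ℝ, IsMLESeq F U Y n ω x ∧
      ∀ b < β, ∀ᶠ j in atTop, b < weightedKL F U n ω (x j) θ} ≤ P {ω | ENNReal.ofReal c ≤ M ω} := by
    refine measure_mono_ae ?_
    filter_upwards [hP.ae_carrier_ne_zero hθ n, hP.ae_bddAbove_logRatio hθ n] with ω h1 h2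
    rintro ⟨x, hx, hW⟩
    have := exp_le_prod_sum_grid hθ hβ ha ha1 hε hn hm h1 h2 hx hW
    have := ENNReal.ofReal_le_ofReal this
    rw [ENNReal.ofReal_prod_of_nonneg
      fun u _ => Finset.sum_nonneg fun o _ => (Real.exp_pos _).le] at this
    refine this.trans_eq (Finset.prod_congr rfl fun u _ => ?_)
    exact ENNReal.ofReal_sum_of_nonneg fun o _ => (Real.exp_pos _).le
  have hmarkov := mul_meas_ge_le_lintegral (μ := P) hMm (ENNReal.ofReal c)
  rw [hint] at hmarkov
  have h3 := ENNReal.toReal_mono (by finiteness) ((mul_le_mul_right hsub _).trans hmarkov)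
  rw [ENNReal.toReal_mul, ENNReal.toReal_ofReal (Real.exp_pos _).le, ENNReal.toReal_pow] at h3
  rw [Real.exp_neg, ← hc, ← div_eq_mul_inv, le_div_iff₀' (Real.exp_pos _)]
  refine h3.trans_eq ?_
  congr 1

end Deviation

/-! ### Numerical comparison with the stated bound -/

lemma exp_quarter_le : Real.exp (1 / 4) ≤ 1.2841 := by
  have h : Real.exp (1 / 4) ^ 4 ≤ 1.2841 ^ 4 := by
    rw [← Real.exp_nat_mul]
    norm_num
    exact Real.exp_one_lt_d9.le.trans (by norm_num)
  exact le_of_pow_le_pow_left₀ (by norm_num) (by norm_num) h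

/-- The square root `exp ((x - 1) / 2)` has its exponent in `[0, 3/2]` and lies below the chord of
`exp` there. -/
lemma exp_sub_one_le_sq {x : ℝ} (h1 : 1 ≤ x) (h4 : x ≤ 4) :
    Real.exp (x - 1) ≤ (7 / 6 * x) ^ 2 := by
  have h32 : Real.exp (3 / 2) ≤ 9 / 2 := by
    have h : Real.exp (3 / 2) ^ 2 ≤ (9 / 2) ^ 2 := by
      rw [← Real.exp_nat_mul, show ((2 : ℕ) : ℝ) * (3 / 2) = (3 : ℕ) * 1 by norm_num,
        Real.exp_nat_mul]
      calc Real.exp 1 ^ 3 ≤ 2.7182818286 ^ 3 :=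
            pow_le_pow_left₀ (Real.exp_pos 1).le Real.exp_one_lt_d9.le 3
        _ ≤ (9 / 2) ^ 2 := by norm_num
    exact le_of_pow_le_pow_left₀ (by norm_num) (by norm_num) h
  have hconv := convexOn_exp.2 (mem_univ (0 : ℝ)) (mem_univ (3 / 2 : ℝ))
    (show 0 ≤ (4 - x) / 3 by linarith) (show 0 ≤ (x - 1) / 3 by linarith) (by ring)
  simp only [smul_eq_mul, mul_zero, zero_add, Real.exp_zero, mul_one] at hconv
  have h2 : (x - 1) / 3 * Real.exp (3 / 2) ≤ (x - 1) / 3 * (9 / 2) :=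
    mul_le_mul_of_nonneg_left h32 (by linarith)
  have h3 : Real.exp ((x - 1) / 3 * (3 / 2)) ≤ 7 / 6 * x := by linarith
  calc Real.exp (x - 1) = Real.exp ((x - 1) / 3 * (3 / 2)) ^ 2 := by
        rw [← Real.exp_nat_mul]
        congr 1
        push_cast
        ring
    _ ≤ _ := pow_le_pow_left₀ (Real.exp_pos _).le h3 2

/-- The bound is trivial when `x = β / K` is at most `4`. -/
lemma one_le_bound_of_le_four {K : ℕ} (hK : 1 ≤ K) {x q : ℝ} (h1 : 1 ≤ x) (h4 : x ≤ 4)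
    (hq : K * x * 0.6931 ≤ q) :
    1 ≤ 2 * Real.exp 1 * (x * q * Real.exp (1 - x)) ^ K := by
  have hKr : (1 : ℝ) ≤ K := Nat.one_le_cast.2 hK
  have hbase : (K : ℝ) / 2 ≤ x * q * Real.exp (1 - x) := by
    have h2 := exp_sub_one_le_sq h1 h4
    have h3 : Real.exp (1 - x) = (Real.exp (x - 1))⁻¹ := by rw [← Real.exp_neg, neg_sub]
    rw [h3, ← div_eq_mul_inv, le_div_iff₀ (Real.exp_pos _)]
    calc (K : ℝ) / 2 * Real.exp (x - 1) ≤ K / 2 * (7 / 6 * x) ^ 2 :=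
          mul_le_mul_of_nonneg_left h2 (by positivity)
      _ = K * x ^ 2 * (49 / 72) := by ring
      _ ≤ K * x ^ 2 * 0.6931 := mul_le_mul_of_nonneg_left (by norm_num) (by positivity)
      _ = x * (K * x * 0.6931) := by ring
      _ ≤ x * q := mul_le_mul_of_nonneg_left hq (by linarith)
  have he : (2 : ℝ) ≤ Real.exp 1 := by linarith [Real.add_one_le_exp 1]
  have hpow : (1 / 2 : ℝ) ≤ (x * q * Real.exp (1 - x)) ^ K := by
    refine le_trans ?_ (pow_le_pow_left₀ (by positivity) hbase K)
    -- For `K = 1` the base may be as small as 1/2, which the prefactor `2e ≥ 4` makes up for.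
    rcases hK.eq_or_lt with rfl | hK2
    · norm_num
    · have : (1 : ℝ) ≤ (K : ℝ) / 2 := by
        have : (2 : ℝ) ≤ K := by exact_mod_cast hK2
        linarith
      exact le_trans (by norm_num) (one_le_pow₀ this)
  calc (1 : ℝ) ≤ 2 * 2 * (1 / 2) := by norm_num
    _ ≤ _ := mul_le_mul (by linarith) hpow (by norm_num) (by positivity)

/-- Spreads the spare prefactor `2e` over the `K` factors. The last inequality is the worst case `x
= 4`, `L = 0.6931` of `grid_size_le`: `2.6362 = 2 * 0.6931 + 5 / 4` and `2.7724 = 4 * 0.6931`. From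
`K = 6` on, `c = 1` suffices. -/
lemma exists_root_bound {K : ℕ} (hK : 1 ≤ K) :
    ∃ c : ℝ, 1 ≤ c ∧ c ^ K ≤ 2 * Real.exp 1 ∧
      1.2841 * (2.6362 + 2 * Real.log (16 * K)) ≤ 2.7724 * c * K := by
  have he := Real.exp_one_gt_d9
  have hl : Real.log 2 ≤ 0.69315 := Real.log_two_lt_d9.le.trans (by norm_num)
  have key : ∀ (y : ℝ) (j : ℕ), 0 < y → y ≤ 2 ^ j → Real.log y ≤ j * 0.69315 := by
    intro y j hy hyj
    calc Real.log y ≤ Real.log (2 ^ j) := Real.log_le_log hy hyj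
      _ = j * Real.log 2 := by rw [Real.log_pow]
      _ ≤ j * 0.69315 := mul_le_mul_of_nonneg_left hl (Nat.cast_nonneg j)
  rcases lt_or_ge K 6 with h | h
  · interval_cases K
    · have := key (16 * (1 : ℕ)) 4 (by norm_num) (by norm_num)
      exact ⟨5, by norm_num, by linarith, by push_cast at *; linarith⟩
    · have := key (16 * (2 : ℕ)) 5 (by norm_num) (by norm_num)
      exact ⟨2.3, by norm_num, by linarith, by push_cast at *; linarith⟩
    · have := key (16 * (3 : ℕ)) 6 (by norm_num) (by norm_num)
      exact ⟨1.75, by norm_num, by linarith, by push_cast at *; linarith⟩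
    · have := key (16 * (4 : ℕ)) 6 (by norm_num) (by norm_num)
      exact ⟨1.5, by norm_num, by linarith, by push_cast at *; linarith⟩
    · have := key (16 * (5 : ℕ)) 7 (by norm_num) (by norm_num)
      exact ⟨1.4, by norm_num, by linarith, by push_cast at *; linarith⟩
  · have hK6 : (6 : ℝ) ≤ K := by exact_mod_cast h
    have h1 := key 128 7 (by norm_num) (by norm_num)
    have h2 : Real.log (16 * K) = Real.log 128 + Real.log (K / 8) := by
      rw [← Real.log_mul (by norm_num) (by positivity)]
      ring_nf
    have h3 := Real.log_le_sub_one_of_pos (show (0 : ℝ) < K / 8 by positivity)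
    refine ⟨1, le_rfl, by rw [one_pow]; linarith, ?_⟩
    rw [h2]
    push_cast at h1
    linarith

/-- Once the logarithm is linearized at `x = 4`, the right side grows faster in `x` and in `L`, so
the corner `(4, 0.6931)` decides. -/
lemma grid_size_le {K : ℕ} (hK : 1 ≤ K) {x L c : ℝ} (hx : 4 ≤ x) (hL : 0.6931 ≤ L) (hc : 1 ≤ c)
    (hcK : 1.2841 * (2.6362 + 2 * Real.log (16 * K)) ≤ 2.7724 * c * K) :
    (2 * x * (Real.log (4 * (K * x)) + L) + 5) * Real.exp (1 / 4) ≤ c * (x * (K * x * L)) := by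
  have hKr : (1 : ℝ) ≤ K := Nat.one_le_cast.2 hK
  have hlog : Real.log (4 * (K * x)) ≤ Real.log (16 * K) + (x / 4 - 1) := by
    rw [show 4 * (K * x) = (16 * K) * (x / 4) by ring, Real.log_mul (by positivity) (by positivity)]
    linarith [Real.log_le_sub_one_of_pos (show 0 < x / 4 by positivity)]
  set l := Real.log (16 * K)
  have hl0 : 0 ≤ l := Real.log_nonneg (by linarith)
  have hcK1 : 1 ≤ c * K := one_le_mul_of_one_le_of_one_le hc hKr
  have h1 : 2 * x * (Real.log (4 * (K * x)) + L) + 5 ≤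
      x * (2 * (l + (x / 4 - 1) + L) + 5 / 4) := by
    have : 2 * x * (Real.log (4 * (K * x)) + L) ≤ 2 * x * (l + (x / 4 - 1) + L) :=
      mul_le_mul_of_nonneg_left (by linarith) (by linarith)
    linarith
  have h2 : (2 * (l + (x / 4 - 1) + L) + 5 / 4) * 1.2841 ≤ c * K * (x * L) := by
    have ha : 0 ≤ (c * K - 1) * (4 * (L - 0.6931)) :=
      mul_nonneg (by linarith) (by linarith)
    have hb : 0 ≤ (x - 4) * (c * K * L - 0.6931) := by
      refine mul_nonneg (by linarith) ?_
      have : 1 * L ≤ c * K * L := mul_le_mul_of_nonneg_right hcK1 (by linarith)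
      linarith
    linarith
  calc (2 * x * (Real.log (4 * (K * x)) + L) + 5) * Real.exp (1 / 4)
      ≤ (x * (2 * (l + (x / 4 - 1) + L) + 5 / 4)) * 1.2841 :=
        mul_le_mul h1 exp_quarter_le (Real.exp_pos _).le
          (mul_nonneg (by linarith) (by linarith))
    _ = x * ((2 * (l + (x / 4 - 1) + L) + 5 / 4) * 1.2841) := by ring
    _ ≤ x * (c * K * (x * L)) := mul_le_mul_of_nonneg_left h2 (by linarith)
    _ = c * (x * (K * x * L)) := by ring

/-- A number of geometric levels that reaches below `δ`. -/
lemma exists_level_count {x y : ℝ} (hx : 1 < x) (hy : 1 ≤ y) :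
    ∃ m : ℕ, (1 - 1 / x) ^ m ≤ 1 / y ∧ (m : ℝ) ≤ x * Real.log y + 1 := by
  have hx0 : 0 < x := by linarith
  have hly := Real.log_nonneg hy
  refine ⟨⌈x * Real.log y⌉₊, ?_, (Nat.ceil_lt_add_one (by positivity)).le⟩
  have h0 : 0 ≤ 1 - 1 / x := by
    rw [sub_nonneg, div_le_one hx0]
    exact hx.le
  calc (1 - 1 / x) ^ ⌈x * Real.log y⌉₊ ≤ Real.exp (-(1 / x)) ^ ⌈x * Real.log y⌉₊ :=
        pow_le_pow_left₀ h0 (by linarith [Real.add_one_le_exp (-(1 / x))]) _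
    _ = Real.exp (-(⌈x * Real.log y⌉₊ / x)) := by
        rw [← Real.exp_nat_mul]
        congr 1
        ring
    _ ≤ Real.exp (-Real.log y) := by
        rw [Real.exp_le_exp, neg_le_neg_iff, le_div_iff₀' hx0]
        exact Nat.le_ceil _
    _ = 1 / y := by rw [Real.exp_neg, Real.exp_log (by linarith), one_div]

/-- Either the bound of the theorem is trivial, or the parameters of the deviation inequality can
be chosen so as to imply it. -/
lemma bound_trivial_or_exists {K n : ℕ} (hK : 1 ≤ K) (hn : 2 ≤ n) {β : ℝ}
    (hβ : (K : ℝ) + 1 + Real.log 2 ≤ β) :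
    1 ≤ 2 * Real.exp (-β) * (β * (⌈β * Real.log n⌉ : ℝ) / K) ^ K * Real.exp ((K : ℝ) + 1) ∨
    ∃ m : ℕ, β * (1 - K / β) ^ m ≤ 1 / 4 / n ∧
      (2 * m + 3 : ℝ) ^ K * Real.exp (-((1 - K / β) * (β - K * (1 / 4)))) ≤
        2 * Real.exp (-β) * (β * (⌈β * Real.log n⌉ : ℝ) / K) ^ K * Real.exp ((K : ℝ) + 1) := by
  have hKr : (1 : ℝ) ≤ K := Nat.one_le_cast.2 hK
  have hn2 : (2 : ℝ) ≤ n := by exact_mod_cast hn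
  have hl2 : 0.6931 ≤ Real.log 2 := le_trans (by norm_num) Real.log_two_gt_d9.le
  have hβ0 : 0 < β := by linarith
  obtain ⟨x, hx⟩ : ∃ x, x = β / K := ⟨_, rfl⟩
  have hβx : β = K * x := by
    rw [hx]
    field_simp
  have hx1 : 1 < x := by
    rw [hx, lt_div_iff₀ (by linarith)]
    linarith
  have hL : 0.6931 ≤ Real.log n := hl2.trans (Real.log_le_log (by norm_num) hn2)
  set L := Real.log n
  set q : ℝ := (⌈β * L⌉ : ℝ) with hq
  have hqL : K * x * L ≤ q := by
    rw [← hβx]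
    exact Int.le_ceil _
  have hR : 2 * Real.exp (-β) * (β * q / K) ^ K * Real.exp ((K : ℝ) + 1) =
      2 * Real.exp 1 * (x * q * Real.exp (1 - x)) ^ K := by
    rw [show β * q / K = x * q by rw [hx]; ring, mul_pow (x * q), ← Real.exp_nat_mul,
      show (K : ℝ) * (1 - x) = -β + K by rw [hβx]; ring, Real.exp_add, Real.exp_add]
    ring
  rw [hR]
  rcases le_total x 4 with h4 | h4
  · left
    refine one_le_bound_of_le_four hK hx1.le h4 (le_trans ?_ hqL)
    exact mul_le_mul_of_nonneg_left hL (by positivity)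
  right
  have hKβ : (K : ℝ) / β = 1 / x := by rw [hx, one_div_div]
  -- This `y` brings the last level down to `ε / n` with `ε = 1 / 4`.
  obtain ⟨m, hm1, hm2⟩ := exists_level_count (y := 4 * β * n) hx1 (by nlinarith)
  refine ⟨m, ?_, ?_⟩
  · rw [hKβ]
    calc β * (1 - 1 / x) ^ m ≤ β * (1 / (4 * β * n)) := mul_le_mul_of_nonneg_left hm1 hβ0.le
      _ = 1 / 4 / n := by field_simp
  obtain ⟨c, hc1, hcp, hcK⟩ := exists_root_bound hK
  have hsize := grid_size_le hK h4 hL hc1 hcK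
  have hlog : Real.log (4 * β * n) = Real.log (4 * (K * x)) + L := by
    rw [Real.log_mul (by positivity) (by positivity), hβx]
  rw [hlog] at hm2
  have hB : (2 * m + 3) * Real.exp (1 / 4) ≤ c * (x * q) := by
    calc (2 * m + 3) * Real.exp (1 / 4)
        ≤ (2 * x * (Real.log (4 * (K * x)) + L) + 5) * Real.exp (1 / 4) :=
          mul_le_mul_of_nonneg_right (by linarith) (Real.exp_pos _).le
      _ ≤ c * (x * (K * x * L)) := hsize
      _ ≤ c * (x * q) := by gcongr
  have hq0 : 0 ≤ q := le_trans (by positivity) hqL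
  calc (2 * m + 3 : ℝ) ^ K * Real.exp (-((1 - K / β) * (β - K * (1 / 4))))
      ≤ (2 * m + 3 : ℝ) ^ K * (Real.exp (1 / 4) ^ K * Real.exp (1 - x) ^ K) := by
        refine mul_le_mul_of_nonneg_left ?_ (by positivity)
        rw [← Real.exp_nat_mul, ← Real.exp_nat_mul, ← Real.exp_add, Real.exp_le_exp, hKβ, hβx]
        have : 0 ≤ (K : ℝ) / (4 * x) := by positivity
        -- The term `-K / (4 * x)` only helps and is dropped; `K / 4` is absorbed into the grid
        -- size.
        have h5 : -((1 - 1 / x) * (K * x - K * (1 / 4))) =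
            K * (1 / 4) + K * (1 - x) - K / (4 * x) := by
          field_simp
          ring
        linarith
    _ = ((2 * m + 3) * Real.exp (1 / 4)) ^ K * Real.exp (1 - x) ^ K := by
        rw [mul_pow, mul_assoc]
    _ ≤ (c * (x * q)) ^ K * Real.exp (1 - x) ^ K := by gcongr
    _ = c ^ K * (x * q * Real.exp (1 - x)) ^ K := by rw [mul_pow c, mul_pow (x * q), mul_assoc]
    _ ≤ _ := by gcongr

lemma IsMLE.isMLESeq {Ω 𝒰 : Type*} {ν : Measure ℝ} [Fintype 𝒰] [DecidableEq 𝒰]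
    {F : 𝒰 → ExpFamily ν} {U : ℕ → Ω → 𝒰} {Y : ℕ → Ω → ℝ} {n : ℕ} {ω : Ω} {ϑ : 𝒰 → ℝ}
    (h : IsMLE F U Y n ω ϑ) : IsMLESeq F U Y n ω fun _ => ϑ :=
  ⟨fun _ => h.1, fun _ hθ' _ hℓ => Eventually.of_forall fun _ => hℓ.trans_le (h.2 hθ')⟩

end ControlledSensing

end

theorem mainTheorem6 {Ω 𝒰 : Type*} [MeasurableSpace Ω]
    [Fintype 𝒰] [DecidableEq 𝒰] [MeasurableSpace 𝒰] [DiscreteMeasurableSpace 𝒰]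
    (ν : Measure ℝ) (F : 𝒰 → ControlledSensing.ExpFamily ν)
    (θ : 𝒰 → ℝ) (hθ : θ ∈ ControlledSensing.paramDomain F)
    (U : ℕ → Ω → 𝒰) (Y : ℕ → Ω → ℝ) (P : Measure Ω) [IsProbabilityMeasure P]
    (hP : ControlledSensing.IsControlledProcess F θ U Y P)
    (n : ℕ) (hn : 2 ≤ n) (β : ℝ) (hβ : (Fintype.card 𝒰 : ℝ) + 1 + Real.log 2 ≤ β) :
    -- outcomes on which a maximum likelihood estimate exists
    (∀ θstar : Ω → 𝒰 → ℝ,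
      P.real {ω | ControlledSensing.IsMLE F U Y n ω (θstar ω) ∧
          β ≤ ControlledSensing.weightedKL F U n ω (θstar ω) θ} ≤
        2 * Real.exp (-β) *
          (β * (⌈β * Real.log n⌉ : ℝ) / (Fintype.card 𝒰 : ℝ)) ^ Fintype.card 𝒰 *
            Real.exp ((Fintype.card 𝒰 : ℝ) + 1)) ∧
    -- all outcomes, with the estimate replaced by a sequence that maximizes the likelihood
    P.real {ω | ∃ ϑ : ℕ → 𝒰 → ℝ, ControlledSensing.IsMLESeq F U Y n ω ϑ ∧
        ∀ b < β, ∀ᶠ j in atTop, b < ControlledSensing.weightedKL F U n ω (ϑ j) θ} ≤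
      2 * Real.exp (-β) *
        (β * (⌈β * Real.log n⌉ : ℝ) / (Fintype.card 𝒰 : ℝ)) ^ Fintype.card 𝒰 *
          Real.exp ((Fintype.card 𝒰 : ℝ) + 1) := by
  have hΩ : Nonempty Ω := nonempty_of_isProbabilityMeasure P
  have hU : Nonempty 𝒰 := ⟨U 1 (Classical.arbitrary Ω)⟩
  have hK : 1 ≤ Fintype.card 𝒰 := Fintype.card_pos
  have hKr : (1 : ℝ) ≤ Fintype.card 𝒰 := Nat.one_le_cast.2 hK
  have hl2 : 0 < Real.log 2 := Real.log_pos one_lt_two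
  have hβ0 : 0 < β := by linarith
  have hseq : P.real {ω | ∃ ϑ : ℕ → 𝒰 → ℝ, ControlledSensing.IsMLESeq F U Y n ω ϑ ∧
        ∀ b < β, ∀ᶠ j in atTop, b < ControlledSensing.weightedKL F U n ω (ϑ j) θ} ≤
      2 * Real.exp (-β) *
        (β * (⌈β * Real.log n⌉ : ℝ) / (Fintype.card 𝒰 : ℝ)) ^ Fintype.card 𝒰 *
          Real.exp ((Fintype.card 𝒰 : ℝ) + 1) := by
    rcases ControlledSensing.bound_trivial_or_exists hK hn hβ with h | ⟨m, hm, hle⟩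
    · exact measureReal_le_one.trans h
    · refine (hP.measureReal_le hθ hβ0 ?_ ?_ (by norm_num) (by omega) hm).trans hle
      · rw [sub_pos, div_lt_one hβ0]
        linarith
      · exact sub_lt_self _ (by positivity)
  refine ⟨fun θstar => (measureReal_mono ?_).trans hseq, hseq⟩
  rintro ω ⟨h1, h2⟩
  exact ⟨fun _ => θstar ω, h1.isMLESeq, fun b hb => Eventually.of_forall fun _ => hb.trans_le h2⟩
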